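/- Let $m,n\in\mathbb{N}$, let $A_1,\dots,A_m\in\mathbb{R}^{n\times n}$ be symmetric matrices with $\sum_{i=1}^m |A_i|\preceq I_n$, and let $\varepsilon\in(0,1)$ be such that $m=\frac{n}{\varepsilon^2}\ge 100$. Here $|A|:=\sum_j|\lambda_j|v_jv_j^\top$ for a symmetric matrix $A$ with orthonormal eigendecomposition $A=\sum_j\lambda_jv_jv_j^\top$, and $\preceq$ is the positive semidefinite (Loewner) order. Let \[ K:=\Big\{x\in\mathbb{R}^m : \Big\|\sum_{i=1}^m x_iA_i\Big\|_{\mathrm{op}}\le\varepsilon\Big\}, \] where $\|\cdot\|_{\mathrm{op}}$ is the operator norm with respect to the Euclidean norm. Then the mean width \[ w(K):=\mathbb{E}_{a}\Big[\sup_{x,y\in K}|\langle a,x-y\rangle|\Big]\in[0,\infty], \] where $a$ is uniformly distributed on the unit sphere $S^{m-1}\subset\mathbb{R}^m$, satisfies \[ w(K)>\frac{\sqrt m}{10000}; \] in particular $w(K)\ge\Omega(\sqrt m)$ with a universal constant. -/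

import Mathlib

open MeasureTheory
open scoped ENNReal MatrixOrder Matrix.Norms.L2Operator

noncomputable section

/-- The absolute value `|A| = ∑ⱼ |λⱼ| vⱼ vⱼᵀ` of a real symmetric matrix with eigendecomposition
`A = ∑ⱼ λⱼ vⱼ vⱼᵀ`. -/
def symmAbs {n : ℕ} {A : Matrix (Fin n) (Fin n) ℝ} (hA : A.IsHermitian) :
    Matrix (Fin n) (Fin n) ℝ :=
  ∑ j, |hA.eigenvalues j| •
    Matrix.vecMulVec (hA.eigenvectorBasis j).ofLp (hA.eigenvectorBasis j).ofLp

/-- The body `{x ∈ ℝᵐ : ‖∑ᵢ xᵢ Aᵢ‖ₒₚ ≤ ε}`; the norm is the operator norm of a matrix with respect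
to the Euclidean norm. -/
def opNormBody {n m : ℕ} (A : Fin m → Matrix (Fin n) (Fin n) ℝ) (ε : ℝ) :
    Set (EuclideanSpace ℝ (Fin m)) :=
  {x | ‖∑ i, x i • A i‖ ≤ ε}

/-- The uniform probability distribution on the unit sphere of `ℝᵐ` (for `m ≥ 1`). -/
def uniformSphere (m : ℕ) : Measure (Metric.sphere (0 : EuclideanSpace ℝ (Fin m)) 1) :=
  ((volume : Measure (EuclideanSpace ℝ (Fin m))).toSphere Set.univ)⁻¹ •
    (volume : Measure (EuclideanSpace ℝ (Fin m))).toSphere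

/-- The mean width `w(K) = 𝔼ₐ sup {|⟨a, x - y⟩| : x, y ∈ K}`, for `a` uniform on the unit sphere.
It takes values in `[0, ∞]`, because `K` may be unbounded. -/
def meanWidth {m : ℕ} (K : Set (EuclideanSpace ℝ (Fin m))) : ℝ≥0∞ :=
  ∫⁻ a, ⨆ x ∈ K, ⨆ y ∈ K,
    ENNReal.ofReal |inner ℝ (a : EuclideanSpace ℝ (Fin m)) (x - y)| ∂(uniformSphere m)

end

/-! A random walk inside the body follows Gaussian noise closely enough to force a large mean width.
With S = ∑ xᵢAᵢ, the walk keeps -b < S < b and tr (b - S)⁻¹ + tr (b + S)⁻¹ ≤ Φ, while the barrier b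
rises from ε/2 to ε. From each position there is a subspace V of dimension at least 0.49 m such that
a step r y, with y ∈ V and ‖y‖² ≤ 230 m, costs only a rise βr² of b. Each step takes for y the
truncated projection onto V of a fresh standard Gaussian. Over total time T = ε/(2β) the noises add
up to √T g, the walk ends in the body K, and noise and endpoint have expected inner product at least
0.39 m T. Hence the support function satisfies E h_K(g) ≥ 0.39 m √T. Here β is a constant times ε,
so T is absolute; polar coordinates and E‖g‖ ≤ √m turn this into a width of order √m.

Existence of V: put P = (b - S)⁻¹, N = (b + S)⁻¹ and S₂ = tr P² + tr N². Raising b by βr² lowers the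
potential by about βr² S₂. The second-order effect of y is a quadratic form with diagonal at most
aᵢcᵢ, where ∑ aᵢ ≤ Φ and ∑ cᵢ ≤ S₂ because ∑ |Aᵢ| ≤ I (`trace_mul_mul_mul_le_mul_trace_symmAbs`). On
about half the dimensions the form is at most 16 Φ S₂ ‖y‖²/m² (`exists_submodule_quadForm_le`),
which is of order ε S₂ since Φ = 4n/ε = 4mε. One more linear constraint cancels the first-order
effect. `BarrierBound.step` combines these, and `BarrierBound.le_lintegral_supportFun` runs the
walk. -/

/-! ### Gaussian convolution, density and polar coordinates. -/

section Gaussian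

open ProbabilityTheory

variable {E : Type*} [NormedAddCommGroup E] [InnerProductSpace ℝ E] [FiniteDimensional ℝ E]
  [MeasurableSpace E] [BorelSpace E]

/-- The exponents of the characteristic functions add. This merges the separate noises of the walk
into one Gaussian. -/
theorem stdGaussian_conv_map_sqrt_smul {s t : ℝ} (hs : 0 ≤ s) (ht : 0 ≤ t) :
    ((stdGaussian E).map (√s • ·)) ∗ ((stdGaussian E).map (√t • ·)) =
      (stdGaussian E).map (√(s + t) • ·) := by
  have h1 : ∀ r : ℝ, IsProbabilityMeasure ((stdGaussian E).map (r • ·)) := fun r =>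
    Measure.isProbabilityMeasure_map (by fun_prop)
  have := h1 √s
  have := h1 √t
  have := h1 √(s + t)
  apply Measure.ext_of_charFun
  ext u
  rw [charFun_conv, charFun_map_smul, charFun_map_smul, charFun_map_smul, charFun_stdGaussian,
    charFun_stdGaussian, charFun_stdGaussian, ← Complex.exp_add]
  congr 1
  simp only [norm_smul, Real.norm_eq_abs, abs_of_nonneg (Real.sqrt_nonneg _)]
  norm_cast
  rw [mul_pow, mul_pow, mul_pow, Real.sq_sqrt hs, Real.sq_sqrt ht, Real.sq_sqrt (add_nonneg hs ht)]
  ring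

theorem lintegral_stdGaussian_semigroup {f : E → ℝ≥0∞} (hf : Measurable f) (w : E) {s t : ℝ}
    (hs : 0 ≤ s) (ht : 0 ≤ t) :
    ∫⁻ g, ∫⁻ g', f (w + √s • g + √t • g') ∂(stdGaussian E) ∂(stdGaussian E) =
      ∫⁻ g, f (w + √(s + t) • g) ∂(stdGaussian E) := by
  have h1 : ∀ r : ℝ, IsProbabilityMeasure ((stdGaussian E).map (r • ·)) := fun r =>
    Measure.isProbabilityMeasure_map (by fun_prop)
  have := h1 √s
  have := h1 √t
  have hw : Measurable fun x => f (w + x) := hf.comp (measurable_const_add w)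
  have key : ∫⁻ x, f (w + x) ∂((stdGaussian E).map (√(s + t) • ·)) =
      ∫⁻ g, f (w + √(s + t) • g) ∂(stdGaussian E) :=
    lintegral_map hw (by fun_prop)
  rw [← key, ← stdGaussian_conv_map_sqrt_smul hs ht, Measure.lintegral_conv hw,
    lintegral_map _ (by fun_prop)]
  · refine lintegral_congr fun g => ?_
    have hg : Measurable fun y => f (w + (√s • g + y)) := hw.comp (measurable_const_add _)
    rw [lintegral_map hg (by fun_prop)]
    simp only [add_assoc]
  · have : Measurable fun p : E × E => f (w + (p.1 + p.2)) := hf.comp (by fun_prop)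
    exact this.lintegral_prod_right'

theorem integrable_exp_neg_norm_sq_half :
    Integrable (fun x : E => Real.exp (-‖x‖ ^ 2 / 2)) := by
  by_contra hcon
  -- A non-integrable function would have Bochner integral `0`, but the Gaussian formula gives a
  -- positive value.
  have := GaussianFourier.integral_rexp_neg_mul_sq_norm (V := E) (b := 1 / 2) (by norm_num)
  have h2 : ∫ v : E, Real.exp (-(1 / 2) * ‖v‖ ^ 2) = 0 := by
    refine integral_undef ?_
    convert hcon using 4
    ring
  rw [h2] at this
  have : (0 : ℝ) < (Real.pi / (1 / 2)) ^ (Module.finrank ℝ E / 2 : ℝ) := by positivity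
  linarith

theorem exists_stdGaussian_eq_smul_withDensity :
    ∃ c : ℝ≥0∞, stdGaussian E =
      c • (volume : Measure E).withDensity fun x => ENNReal.ofReal (Real.exp (-‖x‖ ^ 2 / 2)) := by
  set ν := (volume : Measure E).withDensity fun x => ENNReal.ofReal (Real.exp (-‖x‖ ^ 2 / 2))
    with hν
  set Z : ℝ := (Real.pi / (1 / 2)) ^ (Module.finrank ℝ E / 2 : ℝ) with hZ
  have hZ0 : 0 < Z := by positivity
  have hfin : IsFiniteMeasure ν :=
    isFiniteMeasure_withDensity_ofReal integrable_exp_neg_norm_sq_half.2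
  refine ⟨ENNReal.ofReal Z⁻¹, ?_⟩
  have : IsFiniteMeasure (ENNReal.ofReal Z⁻¹ • ν) := Measure.smul_finite _ ENNReal.ofReal_ne_top
  apply Measure.ext_of_charFun
  ext u
  rw [charFun_stdGaussian, charFun_apply, integral_smul_measure, hν,
    integral_withDensity_eq_integral_toReal_smul (by fun_prop) (by simp)]
  have h3 := GaussianFourier.integral_cexp_neg_mul_sq_norm_add (V := E) (b := 1 / 2)
    (by norm_num) Complex.I u
  have h4 : ∫ v : E, (ENNReal.ofReal (Real.exp (-‖v‖ ^ 2 / 2))).toReal •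
      Complex.exp (inner ℝ v u * Complex.I) =
      (Real.pi / (1 / 2)) ^ (Module.finrank ℝ E / 2 : ℂ) *
        Complex.exp (Complex.I ^ 2 * ‖u‖ ^ 2 / (4 * (1 / 2))) := by
    rw [← h3]
    refine integral_congr_ae (.of_forall fun v => ?_)
    simp only
    rw [ENNReal.toReal_ofReal (Real.exp_pos _).le, Complex.real_smul, Complex.ofReal_exp,
      ← Complex.exp_add, real_inner_comm]
    congr 1
    push_cast
    ring
  rw [h4]
  have h5 : ((Real.pi : ℂ) / (1 / 2)) ^ (Module.finrank ℝ E / 2 : ℂ) = (Z : ℂ) := by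
    rw [hZ, Complex.ofReal_cpow (by positivity)]
    push_cast
    rfl
  rw [h5, ENNReal.toReal_ofReal (by positivity), Complex.real_smul, ← mul_assoc]
  have h6 : ((Z⁻¹ : ℝ) : ℂ) * (Z : ℂ) = 1 := by
    rw [← Complex.ofReal_mul, inv_mul_cancel₀ hZ0.ne', Complex.ofReal_one]
  rw [h6, one_mul, Complex.I_sq]
  congr 1
  ring

/-- Polar coordinates split a 1-homogeneous integrand into angular and radial factors. Since `c`
does not depend on `h`, one test function suffices to control it. -/
theorem exists_lintegral_stdGaussian_eq_mul_toSphere [Nontrivial E] :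
    ∃ c : ℝ≥0∞, ∀ h : E → ℝ≥0∞, Measurable h →
      (∀ (r : ℝ) (x : E), 0 < r → h (r • x) = ENNReal.ofReal r * h x) →
      ∫⁻ x, h x ∂(stdGaussian E) = c * ∫⁻ θ, h θ ∂((volume : Measure E).toSphere) := by
  obtain ⟨c, hc⟩ := exists_stdGaussian_eq_smul_withDensity (E := E)
  refine ⟨c * ∫⁻ r : Set.Ioi (0 : ℝ), ENNReal.ofReal (Real.exp (-r.1 ^ 2 / 2)) * ENNReal.ofReal r.1
      ∂(Measure.volumeIoiPow (Module.finrank ℝ E - 1)), fun h hh hhom => ?_⟩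
  rw [hc, lintegral_smul_measure, lintegral_withDensity_eq_lintegral_mul _ (by fun_prop) hh,
    smul_eq_mul, mul_assoc]
  congr 1
  have hmp := (volume : Measure E).measurePreserving_homeomorphUnitSphereProd
  set F : E → ℝ≥0∞ := fun x => ENNReal.ofReal (Real.exp (-‖x‖ ^ 2 / 2)) * h x with hF
  have hFm : Measurable F := by fun_prop
  calc ∫⁻ x, F x = ∫⁻ x in ({0}ᶜ : Set E), F x := by rw [restrict_compl_singleton]
    _ = ∫⁻ x : ({0}ᶜ : Set E), F (x : E) ∂(Measure.comap (Subtype.val : ({0}ᶜ : Set E) → E) volume) := by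
        rw [lintegral_subtype_comap (measurableSet_singleton _).compl]
    _ = ∫⁻ p : Metric.sphere (0 : E) 1 × Set.Ioi (0 : ℝ), F (p.2.1 • p.1.1)
          ∂((volume : Measure E).toSphere.prod
            (Measure.volumeIoiPow (Module.finrank ℝ E - 1))) := by
        rw [← hmp.lintegral_comp (by fun_prop)]
        refine lintegral_congr fun x => ?_
        congr 1
        simp only [homeomorphUnitSphereProd_apply_snd_coe, homeomorphUnitSphereProd_apply_fst_coe]
        rw [smul_smul, mul_inv_cancel₀ (norm_ne_zero_iff.2 x.2), one_smul]
    _ = ∫⁻ p : Metric.sphere (0 : E) 1 × Set.Ioi (0 : ℝ), h p.1 *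
          (ENNReal.ofReal (Real.exp (-p.2.1 ^ 2 / 2)) * ENNReal.ofReal p.2.1)
          ∂((volume : Measure E).toSphere.prod
            (Measure.volumeIoiPow (Module.finrank ℝ E - 1))) := by
        refine lintegral_congr fun p => ?_
        have h1 : ‖p.2.1 • p.1.1‖ = p.2.1 := by
          rw [norm_smul, norm_eq_of_mem_sphere, mul_one, Real.norm_of_nonneg (le_of_lt p.2.2)]
        simp only [hF]
        rw [h1, hhom _ _ p.2.2]
        ring
    _ = _ := by
        rw [lintegral_prod_mul (f := fun θ : Metric.sphere (0 : E) 1 => h θ)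
          (g := fun r : Set.Ioi (0 : ℝ) =>
            ENNReal.ofReal (Real.exp (-r.1 ^ 2 / 2)) * ENNReal.ofReal r.1)
          (by fun_prop) (by fun_prop), mul_comm]

end Gaussian

/-! ### Truncated projections: Gaussian steps of bounded length. -/

section TruncatedProjection

variable {E : Type*} [NormedAddCommGroup E] [InnerProductSpace ℝ E] [FiniteDimensional ℝ E]

/-- The orthogonal projection onto `V`, cut off to zero outside the ball of radius `√ρ`. -/
noncomputable def truncatedProjection (V : Submodule ℝ E) (ρ : ℝ) (g : E) : E :=
  if ‖g‖ ^ 2 ≤ ρ then V.starProjection g else 0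

theorem truncatedProjection_mem (V : Submodule ℝ E) (ρ : ℝ) (g : E) :
    truncatedProjection V ρ g ∈ V := by
  unfold truncatedProjection
  split_ifs
  · exact Submodule.starProjection_apply_mem V g
  · exact V.zero_mem

theorem norm_truncatedProjection_sq_le (V : Submodule ℝ E) {ρ : ℝ} (hρ : 0 ≤ ρ) (g : E) :
    ‖truncatedProjection V ρ g‖ ^ 2 ≤ ρ := by
  unfold truncatedProjection
  split_ifs with h
  · exact (pow_le_pow_left₀ (norm_nonneg _) (V.norm_starProjection_apply_le g) 2).trans h
  · simpa using hρ

theorem norm_truncatedProjection_le (V : Submodule ℝ E) (ρ : ℝ) (g : E) :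
    ‖truncatedProjection V ρ g‖ ≤ ‖g‖ := by
  unfold truncatedProjection
  split_ifs with h
  · exact V.norm_starProjection_apply_le g
  · simp

end TruncatedProjection

/-! ### Gaussian moments and the expected gain of one step. -/

section GaussianMoments

open ProbabilityTheory

theorem ofReal_integral_le_lintegral_ofReal {α : Type*} [MeasurableSpace α] {μ : Measure α}
    {f : α → ℝ} (hf : Integrable f μ) :
    ENNReal.ofReal (∫ x, f x ∂μ) ≤ ∫⁻ x, ENNReal.ofReal (f x) ∂μ := by
  have h1 : ∫ x, f x ∂μ ≤ ∫ x, max (f x) 0 ∂μ :=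
    integral_mono hf hf.pos_part fun x => le_max_left _ _
  refine (ENNReal.ofReal_le_ofReal h1).trans ?_
  rw [ofReal_integral_eq_lintegral_ofReal hf.pos_part (.of_forall fun x => le_max_right _ _)]
  refine lintegral_mono fun x => ?_
  rcases le_total (f x) 0 with h | h
  · simp [h]
  · simp [h]

/-- The term (2t)⁴/4! = 2t⁴/3 of the exponential series, at t = |x|; exponential moments of a
Gaussian are explicit. -/
theorem pow_four_le_exp_add_exp (x : ℝ) :
    x ^ 4 ≤ 3 / 2 * (Real.exp (2 * x) + Real.exp (-2 * x)) := by
  have key : ∀ t : ℝ, 0 ≤ t → t ^ 4 ≤ 3 / 2 * Real.exp (2 * t) := fun t ht => by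
    have h := Real.pow_div_factorial_le_exp (2 * t) (by positivity) 4
    have h4 : ((Nat.factorial 4 : ℕ) : ℝ) = 24 := by norm_num [Nat.factorial]
    rw [h4] at h
    nlinarith
  rcases le_total 0 x with h | h
  · have := key x h
    have := Real.exp_pos (-2 * x)
    linarith
  · have h1 := key (-x) (by linarith)
    have := Real.exp_pos (2 * x)
    rw [show 2 * -x = -2 * x by ring, show (-x) ^ 4 = x ^ 4 by ring] at h1
    linarith

theorem integral_pow_four_gaussianReal_le : ∫ x, x ^ 4 ∂(gaussianReal 0 1) ≤ 23 := by
  have hint := fun t => integrable_exp_mul_gaussianReal (μ := 0) (v := 1) t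
  have hval : ∀ t : ℝ, ∫ x, Real.exp (t * x) ∂(gaussianReal 0 1) = Real.exp (t ^ 2 / 2) := by
    intro t
    have := mgf_gaussianReal (p := gaussianReal 0 1) (X := id) (μ := 0) (v := 1)
      Measure.map_id t
    simpa [mgf] using this
  have h1 : ∫ x, x ^ 4 ∂(gaussianReal 0 1) ≤
      ∫ x, 3 / 2 * (Real.exp (2 * x) + Real.exp (-2 * x)) ∂(gaussianReal 0 1) :=
    integral_mono_of_nonneg (.of_forall fun x => by positivity)
      (((hint 2).add (hint (-2))).const_mul _) (.of_forall pow_four_le_exp_add_exp)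
  rw [integral_const_mul, integral_add (hint 2) (hint (-2)), hval, hval] at h1
  -- The bound reached so far is 3e², about 22.2.
  have h2 : Real.exp 2 ≤ 2.7182818286 ^ 2 := by
    rw [show (2 : ℝ) = 1 + 1 by norm_num, Real.exp_add, ← sq]
    exact pow_le_pow_left₀ (Real.exp_pos _).le Real.exp_one_lt_d9.le 2
  norm_num at h1 h2
  linarith

variable {E : Type*} [NormedAddCommGroup E] [InnerProductSpace ℝ E] [FiniteDimensional ℝ E]
  [MeasurableSpace E] [BorelSpace E]

theorem integral_inner_stdGaussian (u : E) : ∫ g, inner ℝ u g ∂(stdGaussian E) = 0 :=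
  integral_strongDual_stdGaussian (innerSL ℝ u)

theorem integrable_inner_stdGaussian (u : E) :
    Integrable (fun g => inner ℝ u g) (stdGaussian E) :=
  (IsGaussian.memLp_dual (stdGaussian E) (innerSL ℝ u) 1 (by simp)).integrable le_rfl

theorem integrable_inner_sq_stdGaussian (u : E) :
    Integrable (fun g => inner ℝ u g ^ 2) (stdGaussian E) :=
  (IsGaussian.memLp_dual (stdGaussian E) (innerSL ℝ u) 2 (by simp)).integrable_sq

theorem integral_inner_sq_stdGaussian (u : E) :
    ∫ g, inner ℝ u g ^ 2 ∂(stdGaussian E) = ‖u‖ ^ 2 := by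
  have h := variance_dual_stdGaussian (innerSL ℝ u)
  rw [variance_of_integral_eq_zero (by fun_prop) (integral_strongDual_stdGaussian _)] at h
  simpa using h

theorem integrable_inner_pow_four_stdGaussian (u : E) :
    Integrable (fun g => inner ℝ u g ^ 4) (stdGaussian E) := by
  have h := (IsGaussian.memLp_dual (stdGaussian E) (innerSL ℝ u) 4 (by simp)).integrable_norm_pow
    (p := 4) (by norm_num)
  refine h.congr (.of_forall fun g => ?_)
  simp only [Real.norm_eq_abs, innerSL_apply_apply]
  exact Even.pow_abs (by decide) _

theorem integral_inner_pow_four_stdGaussian_le {u : E} (hu : ‖u‖ = 1) :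
    ∫ g, inner ℝ u g ^ 4 ∂(stdGaussian E) ≤ 23 := by
  have h := IsGaussian.map_eq_gaussianReal (μ := stdGaussian E) (innerSL ℝ u)
  rw [variance_dual_stdGaussian, integral_strongDual_stdGaussian, innerSL_apply_norm, hu, one_pow,
    Real.toNNReal_one] at h
  refine le_of_eq_of_le ?_ integral_pow_four_gaussianReal_le
  rw [← h, integral_map (by fun_prop) (by fun_prop)]
  rfl

theorem integrable_norm_sq_stdGaussian : Integrable (fun g : E => ‖g‖ ^ 2) (stdGaussian E) :=
  (IsGaussian.memLp_id (stdGaussian E) 2 (by simp)).integrable_norm_pow (p := 2) (by norm_num)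

theorem integrable_norm_pow_four_stdGaussian :
    Integrable (fun g : E => ‖g‖ ^ 4) (stdGaussian E) :=
  (IsGaussian.memLp_id (stdGaussian E) 4 (by simp)).integrable_norm_pow (p := 4) (by norm_num)

theorem integral_norm_starProjection_sq_stdGaussian (V : Submodule ℝ E) :
    ∫ g, ‖V.starProjection g‖ ^ 2 ∂(stdGaussian E) = Module.finrank ℝ V := by
  have h : ∀ g : E, ‖V.starProjection g‖ ^ 2 =
      ∑ i, inner ℝ ((stdOrthonormalBasis ℝ V i : V) : E) g ^ 2 := fun g => by
    have h1 := (stdOrthonormalBasis ℝ V).sum_sq_norm_inner_right (V.orthogonalProjectionOnto g)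
    rw [Submodule.starProjection_apply, ← Submodule.coe_norm, ← h1]
    refine Finset.sum_congr rfl fun i _ => ?_
    rw [Real.norm_eq_abs, sq_abs, Submodule.coe_inner, ← Submodule.starProjection_apply,
      ← Submodule.inner_starProjection_left_eq_right,
      Submodule.starProjection_eq_self_iff.2 (Subtype.prop _)]
  simp_rw [h]
  rw [integral_finsetSum _ fun i _ => integrable_inner_sq_stdGaussian _]
  simp_rw [integral_inner_sq_stdGaussian]
  have : ∀ i, ‖((stdOrthonormalBasis ℝ V i : V) : E)‖ = 1 := fun i =>
    (stdOrthonormalBasis ℝ V).orthonormal.1 i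
  simp [this]

theorem integral_norm_sq_stdGaussian :
    ∫ g, ‖g‖ ^ 2 ∂(stdGaussian E) = Module.finrank ℝ E := by
  have := integral_norm_starProjection_sq_stdGaussian (⊤ : Submodule ℝ E)
  have htop : ∀ g : E, (⊤ : Submodule ℝ E).starProjection g = g := fun g =>
    Submodule.starProjection_eq_self_iff.2 Submodule.mem_top
  simpa only [htop, finrank_top] using this

/-- Cauchy–Schwarz over the coordinates reduces this to the one-dimensional fourth moment. -/
theorem integral_norm_pow_four_stdGaussian_le :
    ∫ g, ‖g‖ ^ 4 ∂(stdGaussian E) ≤ 23 * (Module.finrank ℝ E : ℝ) ^ 2 := by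
  set b := stdOrthonormalBasis ℝ E
  have h : ∀ g : E, ‖g‖ ^ 4 ≤ Module.finrank ℝ E * ∑ i, inner ℝ (b i) g ^ 4 := fun g => by
    have h1 := b.sum_sq_norm_inner_right g
    have h2 := sq_sum_le_card_mul_sum_sq (s := Finset.univ) (f := fun i => inner ℝ (b i) g ^ 2)
    simp only [Real.norm_eq_abs, sq_abs] at h1
    rw [h1] at h2
    simp only [← pow_mul, Finset.card_univ, Fintype.card_fin] at h2
    exact h2
  have hint : Integrable (fun g => (Module.finrank ℝ E : ℝ) * ∑ i, inner ℝ (b i) g ^ 4)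
      (stdGaussian E) :=
    (integrable_finsetSum _ fun i _ => integrable_inner_pow_four_stdGaussian _).const_mul _
  refine (integral_mono integrable_norm_pow_four_stdGaussian hint h).trans ?_
  rw [integral_const_mul, integral_finsetSum _ fun i _ => integrable_inner_pow_four_stdGaussian _]
  have h3 : ∑ i, ∫ g, inner ℝ (b i) g ^ 4 ∂(stdGaussian E) ≤ ∑ _i : Fin (Module.finrank ℝ E), 23 :=
    Finset.sum_le_sum fun i _ => integral_inner_pow_four_stdGaussian_le (b.orthonormal.1 i)
  rw [Finset.sum_const, Finset.card_univ, Fintype.card_fin, nsmul_eq_mul] at h3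
  have h4 : (0 : ℝ) ≤ Module.finrank ℝ E := by positivity
  nlinarith [mul_le_mul_of_nonneg_left h3 h4]

theorem lintegral_norm_stdGaussian_le :
    ∫⁻ g, ENNReal.ofReal ‖g‖ ∂(stdGaussian E) ≤ ENNReal.ofReal √(Module.finrank ℝ E) := by
  have hint : Integrable (fun g : E => ‖g‖) (stdGaussian E) :=
    (IsGaussian.memLp_id (stdGaussian E) 1 (by simp)).integrable le_rfl |>.norm
  rw [← ofReal_integral_eq_lintegral_ofReal hint (.of_forall fun g => norm_nonneg g)]
  refine ENNReal.ofReal_le_ofReal (Real.le_sqrt_of_sq_le ?_)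
  rw [← integral_norm_sq_stdGaussian]
  have h := variance_nonneg (fun g : E => ‖g‖) (stdGaussian E)
  rw [variance_eq_sub (X := fun g : E => ‖g‖)
    (IsGaussian.memLp_id (stdGaussian E) 2 (by simp)).norm] at h
  simp only [Pi.pow_apply] at h
  exact sub_nonneg.1 h

theorem measurable_truncatedProjection (V : Submodule ℝ E) (ρ : ℝ) :
    Measurable (truncatedProjection V ρ) :=
  Measurable.ite (measurableSet_le (by fun_prop) measurable_const) (by fun_prop) measurable_const

theorem integrable_inner_truncatedProjection (V : Submodule ℝ E) (ρ : ℝ) (w : E) :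
    Integrable (fun g => inner ℝ w (truncatedProjection V ρ g)) (stdGaussian E) := by
  have hint : Integrable (fun g : E => ‖w‖ * ‖g‖) (stdGaussian E) :=
    ((IsGaussian.memLp_id (stdGaussian E) 1 (by simp)).integrable le_rfl |>.norm).const_mul _
  have hm := measurable_truncatedProjection V ρ
  refine hint.mono' (by fun_prop) (.of_forall fun g => ?_)
  exact (norm_inner_le_norm _ _).trans
    (mul_le_mul_of_nonneg_left (norm_truncatedProjection_le V ρ g) (norm_nonneg _))

/-- The truncated projection is odd and the Gaussian is symmetric. -/
theorem integral_inner_truncatedProjection (V : Submodule ℝ E) (ρ : ℝ) (w : E) :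
    ∫ g, inner ℝ w (truncatedProjection V ρ g) ∂(stdGaussian E) = 0 := by
  have hneg := stdGaussian_map (LinearIsometryEquiv.neg ℝ (E := E))
  have hodd : ∀ g, truncatedProjection V ρ (-g) = -truncatedProjection V ρ g := fun g => by
    unfold truncatedProjection
    simp only [norm_neg, map_neg]
    split_ifs <;> simp
  have hm := measurable_truncatedProjection V ρ
  have h : ∫ g, inner ℝ w (truncatedProjection V ρ g) ∂(stdGaussian E) =
      ∫ g, inner ℝ w (truncatedProjection V ρ (-g)) ∂(stdGaussian E) := by
    conv_lhs => rw [← hneg]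
    rw [integral_map (by fun_prop) (by fun_prop)]
    rfl
  simp only [hodd, inner_neg_right, integral_neg] at h
  linarith

theorem integrable_inner_self_truncatedProjection (V : Submodule ℝ E) (ρ : ℝ) :
    Integrable (fun g => inner ℝ g (truncatedProjection V ρ g)) (stdGaussian E) := by
  have hm := measurable_truncatedProjection V ρ
  refine integrable_norm_sq_stdGaussian.mono' (by fun_prop) (.of_forall fun g => ?_)
  refine (norm_inner_le_norm _ _).trans ?_
  rw [sq]
  exact mul_le_mul_of_nonneg_left (norm_truncatedProjection_le V ρ g) (norm_nonneg _)

/-- Truncation loses only where ‖g‖² > ρ, and there the squared projection is at most ‖g‖² ≤ ‖g‖⁴/ρ.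
-/
theorem le_integral_inner_self_truncatedProjection (V : Submodule ℝ E) {ρ : ℝ} (hρ : 0 < ρ) :
    (Module.finrank ℝ V : ℝ) - 23 * (Module.finrank ℝ E : ℝ) ^ 2 / ρ ≤
      ∫ g, inner ℝ g (truncatedProjection V ρ g) ∂(stdGaussian E) := by
  have hpt : ∀ g : E, ‖V.starProjection g‖ ^ 2 - ‖g‖ ^ 4 / ρ ≤
      inner ℝ g (truncatedProjection V ρ g) := fun g => by
    unfold truncatedProjection
    split_ifs with h
    · have h1 : inner ℝ g (V.starProjection g) = ‖V.starProjection g‖ ^ 2 := by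
        have h0 := V.inner_starProjection_left_eq_right g (V.starProjection g)
        rw [Submodule.starProjection_eq_self_iff.2 (V.starProjection_apply_mem g)] at h0
        rw [← h0, real_inner_self_eq_norm_sq]
      rw [h1]
      have : 0 ≤ ‖g‖ ^ 4 / ρ := by positivity
      linarith
    · rw [inner_zero_right, sub_nonpos, le_div_iff₀ hρ]
      have h1 := pow_le_pow_left₀ (norm_nonneg _) (V.norm_starProjection_apply_le g) 2
      rw [not_le] at h
      nlinarith [sq_nonneg ‖g‖]
  have hint1 : Integrable (fun g => ‖V.starProjection g‖ ^ 2) (stdGaussian E) := by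
    refine integrable_norm_sq_stdGaussian.mono' (by fun_prop) (.of_forall fun g => ?_)
    rw [Real.norm_of_nonneg (by positivity)]
    exact pow_le_pow_left₀ (norm_nonneg _) (V.norm_starProjection_apply_le g) 2
  have hint2 := (integrable_norm_pow_four_stdGaussian (E := E)).div_const ρ
  have h := integral_mono (hint1.sub hint2) (integrable_inner_self_truncatedProjection V ρ) hpt
  simp only [Pi.sub_apply] at h
  rw [integral_sub hint1 hint2, integral_norm_starProjection_sq_stdGaussian,
    integral_div] at h
  refine le_trans ?_ h
  have := div_le_div_of_nonneg_right (integral_norm_pow_four_stdGaussian_le (E := E)) hρ.le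
  linarith

/-- One step in expectation: the cross terms have mean zero and the `a ^ 2` term is the gain. `C`
carries the gain of the steps still to come. -/
theorem ofReal_inner_add_le_lintegral_stdGaussian (V : Submodule ℝ E) {ρ : ℝ} (hρ : 0 < ρ)
    (w x : E) (a C : ℝ) :
    ENNReal.ofReal (inner ℝ w x +
        a ^ 2 * ((Module.finrank ℝ V : ℝ) - 23 * (Module.finrank ℝ E : ℝ) ^ 2 / ρ) + C) ≤
      ∫⁻ g, ENNReal.ofReal (inner ℝ (w + a • g) (x + a • truncatedProjection V ρ g) + C)
        ∂(stdGaussian E) := by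
  have hexp : ∀ g, inner ℝ (w + a • g) (x + a • truncatedProjection V ρ g) + C =
      (inner ℝ w x + C) + a * inner ℝ w (truncatedProjection V ρ g) + a * inner ℝ x g +
        a ^ 2 * inner ℝ g (truncatedProjection V ρ g) := fun g => by
    simp only [inner_add_left, inner_add_right, real_inner_smul_left, real_inner_smul_right]
    rw [real_inner_comm x g]
    ring
  simp_rw [hexp]
  have i0 : Integrable (fun _ : E => inner ℝ w x + C) (stdGaussian E) := integrable_const _
  have i1 := (integrable_inner_truncatedProjection V ρ w).const_mul a
  have i2 := (integrable_inner_stdGaussian x).const_mul a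
  have i3 := (integrable_inner_self_truncatedProjection V ρ).const_mul (a ^ 2)
  have i01 : Integrable (fun g => inner ℝ w x + C + a * inner ℝ w (truncatedProjection V ρ g))
    (stdGaussian E) := i0.add i1
  have i012 : Integrable (fun g => inner ℝ w x + C + a * inner ℝ w (truncatedProjection V ρ g) +
    a * inner ℝ x g) (stdGaussian E) := i01.add i2
  refine le_trans (ENNReal.ofReal_le_ofReal ?_)
    (ofReal_integral_le_lintegral_ofReal (i012.add i3))
  rw [integral_add i012 i3, integral_add i01 i2, integral_add i0 i1, integral_const_mul,
    integral_const_mul, integral_const_mul,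
    integral_inner_truncatedProjection, integral_inner_stdGaussian, integral_const,
    probReal_univ, one_smul]
  nlinarith [mul_le_mul_of_nonneg_left (le_integral_inner_self_truncatedProjection V hρ)
    (sq_nonneg a)]

theorem lintegral_stdGaussian_le_sqrt_mul_uniformSphere {m : ℕ} (hm : 0 < m)
    {h : EuclideanSpace ℝ (Fin m) → ℝ≥0∞} (hh : Measurable h)
    (hhom : ∀ (r : ℝ) (x : EuclideanSpace ℝ (Fin m)), 0 < r →
      h (r • x) = ENNReal.ofReal r * h x) :
    ∫⁻ x, h x ∂(stdGaussian (EuclideanSpace ℝ (Fin m))) ≤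
      ENNReal.ofReal √m * ∫⁻ θ, h θ ∂(uniformSphere m) := by
  have : Nonempty (Fin m) := ⟨⟨0, hm⟩⟩
  obtain ⟨c, hc⟩ := exists_lintegral_stdGaussian_eq_mul_toSphere
    (E := EuclideanSpace ℝ (Fin m))
  set τ := (volume : Measure (EuclideanSpace ℝ (Fin m))).toSphere with hτ
  have hτ0 : τ Set.univ ≠ 0 := by
    rw [Ne, Measure.measure_univ_eq_zero]
    exact Measure.toSphere_ne_zero _
  have hτt : τ Set.univ ≠ ∞ := measure_ne_top _ _
  -- Testing with the norm identifies `c * τ univ` as E‖g‖, which is at most √m.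
  have h1 := hc (fun x => ENNReal.ofReal ‖x‖) (by fun_prop) fun r x hr => by
    rw [norm_smul, Real.norm_of_nonneg hr.le, ENNReal.ofReal_mul hr.le]
  have h2 : ∫⁻ θ : Metric.sphere (0 : EuclideanSpace ℝ (Fin m)) 1, 
      ENNReal.ofReal ‖(θ : EuclideanSpace ℝ (Fin m))‖ ∂τ =
      τ Set.univ := by
    simp
  have h3 := lintegral_norm_stdGaussian_le (E := EuclideanSpace ℝ (Fin m))
  rw [h1, h2, finrank_euclideanSpace_fin] at h3
  rw [hc h hh hhom, uniformSphere, lintegral_smul_measure, smul_eq_mul, ← hτ]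
  calc c * ∫⁻ θ, h θ ∂τ = (c * τ Set.univ) * ((τ Set.univ)⁻¹ * ∫⁻ θ, h θ ∂τ) := by
        rw [mul_assoc, ← mul_assoc (τ Set.univ), ENNReal.mul_inv_cancel hτ0 hτt, one_mul]
    _ ≤ _ := by gcongr

end GaussianMoments

/-! ### A large subspace on which a quadratic form is small. -/

section QuadraticForm

theorem Finset.card_filter_lt_mul_le {ι : Type*} [Fintype ι] {a : ι → ℝ} (ha : ∀ i, 0 ≤ a i)
    (t : ℝ) : ((Finset.univ.filter fun i => t < a i).card : ℝ) * t ≤ ∑ i, a i := by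
  calc ((Finset.univ.filter fun i => t < a i).card : ℝ) * t
      = ∑ i ∈ Finset.univ.filter fun i => t < a i, t := by rw [Finset.sum_const, nsmul_eq_mul]
    _ ≤ ∑ i ∈ Finset.univ.filter fun i => t < a i, a i :=
        Finset.sum_le_sum fun i hi => (Finset.mem_filter.1 hi).2.le
    _ ≤ ∑ i, a i := Finset.sum_le_sum_of_subset_of_nonneg (Finset.filter_subset _ _)
        fun i _ _ => ha i

theorem Matrix.IsHermitian.dotProduct_mulVec_eq_sum {ι : Type*} [Fintype ι] [DecidableEq ι]
    {G : Matrix ι ι ℝ} (hG : G.IsHermitian) (y : EuclideanSpace ℝ ι) :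
    y.ofLp ⬝ᵥ (G.mulVec y.ofLp) =
      ∑ j, hG.eigenvalues j * inner ℝ (hG.eigenvectorBasis j) y ^ 2 := by
  have h1 := hG.eigenvectorBasis.sum_inner_mul_inner y (WithLp.toLp 2 (G.mulVec y.ofLp))
  have h2 : inner ℝ y (WithLp.toLp 2 (G.mulVec y.ofLp)) = y.ofLp ⬝ᵥ (G.mulVec y.ofLp) := by
    rw [EuclideanSpace.inner_eq_star_dotProduct, dotProduct_comm]
    simp
  rw [← h2, ← h1]
  refine Finset.sum_congr rfl fun j _ => ?_
  have h3 : inner ℝ (hG.eigenvectorBasis j) (WithLp.toLp 2 (G.mulVec y.ofLp)) =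
      hG.eigenvalues j * inner ℝ (hG.eigenvectorBasis j) y := by
    rw [EuclideanSpace.inner_eq_star_dotProduct, EuclideanSpace.inner_eq_star_dotProduct]
    simp only [star_trivial]
    have hT : G.transpose = G := by simpa [Matrix.IsHermitian] using hG
    rw [dotProduct_comm, Matrix.dotProduct_mulVec, ← Matrix.mulVec_transpose, hT,
      hG.mulVec_eigenvectorBasis, smul_dotProduct, smul_eq_mul, dotProduct_comm]
  rw [h3, real_inner_comm]
  ring

/-- Markov's inequality twice. At most m/4 coordinates have aᵢ > 4Φ/m; without them the trace is at
most 4ΦS/m, so at most m/4 eigenvalues exceed 16ΦS/m². Orthogonality to `l` costs one more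
dimension, and m/2 - 1 ≥ 0.49 m because m ≥ 100. -/
theorem exists_submodule_quadForm_le {m : ℕ} (hm : 100 ≤ m) {G : Matrix (Fin m) (Fin m) ℝ}
    (hG : G.PosSemidef) {a c : Fin m → ℝ} (ha : ∀ i, 0 ≤ a i) (hc : ∀ i, 0 ≤ c i) {Φ S : ℝ}
    (hΦ : 0 < Φ) (hS : 0 < S) (hsa : ∑ i, a i ≤ Φ) (hsc : ∑ i, c i ≤ S)
    (hGi : ∀ i, G i i ≤ a i * c i) (l : EuclideanSpace ℝ (Fin m)) :
    ∃ V : Submodule ℝ (EuclideanSpace ℝ (Fin m)),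
      49 / 100 * (m : ℝ) ≤ Module.finrank ℝ V ∧
      ∀ y ∈ V, inner ℝ l y = 0 ∧
        y.ofLp ⬝ᵥ (G.mulVec y.ofLp) ≤ 16 * Φ * S / (m : ℝ) ^ 2 * ‖y‖ ^ 2 := by
  classical
  have hm0 : (100 : ℝ) ≤ m := by exact_mod_cast hm
  have hmp : (0 : ℝ) < m := by linarith
  set bad : Finset (Fin m) := Finset.univ.filter fun i => 4 * Φ / m < a i with hbad
  set d : Fin m → ℝ := fun i => if i ∈ bad then 0 else 1 with hd
  set D : Matrix (Fin m) (Fin m) ℝ := Matrix.diagonal d with hD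
  have hG' : (D * G * D).PosSemidef := by
    have := hG.mul_mul_conjTranspose_same D
    rwa [hD, Matrix.diagonal_conjTranspose, star_trivial, ← hD] at this
  set μ := hG'.1.eigenvalues with hμ
  set u := hG'.1.eigenvectorBasis with hu
  set t : ℝ := 16 * Φ * S / (m : ℝ) ^ 2 with ht
  have htp : 0 < t := by positivity
  set big : Finset (Fin m) := Finset.univ.filter fun j => t < μ j with hbig
  have hcard1 : (bad.card : ℝ) ≤ m / 4 := by
    have h := (Finset.card_filter_lt_mul_le ha (4 * Φ / m)).trans hsa
    rw [← hbad, ← le_div_iff₀ (by positivity)] at h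
    refine h.trans (le_of_eq ?_)
    field_simp
  have htr : ∑ j, μ j ≤ 4 * Φ / m * S := by
    have h1 : (D * G * D).trace = ∑ j, μ j := by
      have := hG'.1.trace_eq_sum_eigenvalues
      simpa using this
    rw [← h1, Matrix.trace]
    calc ∑ i, (D * G * D).diag i ≤ ∑ i, 4 * Φ / m * c i := by
          refine Finset.sum_le_sum fun i _ => ?_
          rw [Matrix.diag_apply, hD, Matrix.mul_diagonal, Matrix.diagonal_mul]
          simp only [hd]
          split_ifs with hi
          · have := hc i
            simp only [zero_mul, mul_zero]
            positivity
          · rw [one_mul, mul_one]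
            refine (hGi i).trans (mul_le_mul_of_nonneg_right ?_ (hc i))
            simpa [hbad] using hi
      _ = 4 * Φ / m * ∑ i, c i := by rw [Finset.mul_sum]
      _ ≤ _ := by gcongr
  have hcard2 : (big.card : ℝ) ≤ m / 4 := by
    have h := (Finset.card_filter_lt_mul_le (a := μ) (fun j => hG'.eigenvalues_nonneg j) t).trans htr
    rw [← hbig, ← le_div_iff₀ htp] at h
    refine h.trans (le_of_eq ?_)
    rw [ht]
    field_simp
    norm_num
  set s : Finset (EuclideanSpace ℝ (Fin m)) :=
    big.image u ∪ bad.image (fun i => EuclideanSpace.single i (1 : ℝ)) ∪ {l} with hs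
  have hscard : s.card ≤ big.card + bad.card + 1 := by
    refine (Finset.card_union_le _ _).trans ?_
    refine add_le_add ((Finset.card_union_le _ _).trans ?_) (by simp)
    exact add_le_add Finset.card_image_le Finset.card_image_le
  refine ⟨(Submodule.span ℝ (s : Set (EuclideanSpace ℝ (Fin m))))ᗮ, ?_, fun y hy => ?_⟩
  · have h1 := Submodule.finrank_add_finrank_orthogonal
      (Submodule.span ℝ (s : Set (EuclideanSpace ℝ (Fin m))))
    rw [finrank_euclideanSpace_fin] at h1
    have h2 : Module.finrank ℝ (Submodule.span ℝ (s : Set (EuclideanSpace ℝ (Fin m)))) ≤ s.card :=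
      finrank_span_finset_le_card s
    have h3 : ((Module.finrank ℝ (Submodule.span ℝ (s : Set (EuclideanSpace ℝ (Fin m)))) : ℕ) : ℝ) +
      (Module.finrank ℝ (Submodule.span ℝ (s : Set (EuclideanSpace ℝ (Fin m))))ᗮ : ℕ) = m := by
      exact_mod_cast h1
    have h4 : ((Module.finrank ℝ (Submodule.span ℝ (s : Set (EuclideanSpace ℝ (Fin m)))) : ℕ) : ℝ) ≤
        big.card + bad.card + 1 := by exact_mod_cast h2.trans hscard
    linarith
  · have horth : ∀ v ∈ s, inner ℝ v y = 0 := fun v hv =>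
      Submodule.mem_orthogonal _ _ |>.1 hy v (Submodule.subset_span hv)
    refine ⟨horth l (by simp [hs]), ?_⟩
    have hDy : D.mulVec y.ofLp = y.ofLp := by
      ext i
      rw [hD, Matrix.mulVec_diagonal]
      simp only [hd]
      split_ifs with hi
      · have h0 := horth (EuclideanSpace.single i (1 : ℝ))
          (by simp only [hs, Finset.mem_union, Finset.mem_image]; exact .inl (.inr ⟨i, hi, rfl⟩))
        rw [EuclideanSpace.inner_single_left] at h0
        simp only [map_one, one_mul] at h0
        rw [h0, zero_mul]
      · rw [one_mul]
    -- Since `y` vanishes on the bad coordinates, the form of `G` agrees with its compression at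
    -- `y`.
    have hquad : y.ofLp ⬝ᵥ (G.mulVec y.ofLp) = y.ofLp ⬝ᵥ ((D * G * D).mulVec y.ofLp) := by
      rw [← Matrix.mulVec_mulVec, hDy, ← Matrix.mulVec_mulVec, Matrix.dotProduct_mulVec y.ofLp D,
        ← Matrix.mulVec_transpose, hD, Matrix.diagonal_transpose, ← hD, hDy]
    rw [hquad, hG'.1.dotProduct_mulVec_eq_sum]
    have hn := u.sum_sq_norm_inner_right y
    rw [← hn, Finset.mul_sum]
    refine Finset.sum_le_sum fun j _ => ?_
    rw [Real.norm_eq_abs, sq_abs]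
    by_cases hj : j ∈ big
    · have h0 := horth (u j)
        (by simp only [hs, Finset.mem_union, Finset.mem_image]; exact .inl (.inl ⟨j, hj, rfl⟩))
      rw [← hu, h0]
      simp
    · refine mul_le_mul_of_nonneg_right ?_ (sq_nonneg _)
      simpa [hbig] using hj

end QuadraticForm

/-! ### Perturbation of the trace of an inverse. -/

section MatrixEstimates

namespace Matrix

variable {ι : Type*} [Fintype ι]

theorem IsHermitian.dotProduct_mulVec_comm {P : Matrix ι ι ℝ} (hP : P.IsHermitian) (x y : ι → ℝ) :
    x ⬝ᵥ P *ᵥ y = y ⬝ᵥ P *ᵥ x := by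
  have hT : P.transpose = P := by simpa [IsHermitian] using hP
  rw [dotProduct_mulVec, ← mulVec_transpose, hT, dotProduct_comm]

theorem PosSemidef.sq_dotProduct_mulVec_le {P : Matrix ι ι ℝ} (hP : P.PosSemidef) (x y : ι → ℝ) :
    (x ⬝ᵥ P *ᵥ y) ^ 2 ≤ (x ⬝ᵥ P *ᵥ x) * (y ⬝ᵥ P *ᵥ y) := by
  have h : ∀ t : ℝ, 0 ≤ (y ⬝ᵥ P *ᵥ y) * (t * t) + (2 * (x ⬝ᵥ P *ᵥ y)) * t + x ⬝ᵥ P *ᵥ x := by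
    intro t
    have h0 := hP.dotProduct_mulVec_nonneg (x + t • y)
    simp only [star_trivial, mulVec_add, mulVec_smul, add_dotProduct, dotProduct_add,
      smul_dotProduct, dotProduct_smul, smul_eq_mul] at h0
    rw [hP.1.dotProduct_mulVec_comm y x] at h0
    linarith
  have := discrim_le_zero h
  unfold discrim at this
  linarith

theorem toLp_dotProduct_self (v : ι → ℝ) : v ⬝ᵥ v = ‖WithLp.toLp 2 v‖ ^ 2 := by
  rw [EuclideanSpace.real_norm_sq_eq]
  simp [dotProduct, sq]

theorem trace_mul_vecMulVec (X : Matrix ι ι ℝ) (u v : ι → ℝ) :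
    (X * vecMulVec u v).trace = v ⬝ᵥ X *ᵥ u := by
  rw [mul_vecMulVec, trace_vecMulVec, dotProduct_comm]

theorem PosSemidef.mul_self {P : Matrix ι ι ℝ} (hP : P.PosSemidef) : (P * P).PosSemidef := by
  have := posSemidef_conjTranspose_mul_self P
  rwa [hP.1.eq] at this

theorem PosSemidef.trace_conj_mul_conj_nonneg {P A : Matrix ι ι ℝ} (hP : P.PosSemidef)
    (hA : A.IsHermitian) : 0 ≤ (P * A * P * A * P).trace := by
  have h := hP.conjTranspose_mul_mul_same (A * P)
  rw [conjTranspose_mul, hA.eq, hP.1.eq] at h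
  have h2 : P * A * P * A * P = P * A * P * (A * P) := by simp only [Matrix.mul_assoc]
  rw [h2]
  exact h.trace_nonneg

variable [DecidableEq ι]

theorem PosSemidef.dotProduct_mulVec_le_trace {P : Matrix ι ι ℝ} (hP : P.PosSemidef) (v : ι → ℝ) :
    v ⬝ᵥ P *ᵥ v ≤ P.trace * (v ⬝ᵥ v) := by
  have h := hP.1.dotProduct_mulVec_eq_sum (WithLp.toLp 2 v)
  simp only at h
  have htr := hP.1.trace_eq_sum_eigenvalues
  simp only [RCLike.ofReal_real_eq_id, id_eq] at htr
  rw [h, htr, Finset.sum_mul, toLp_dotProduct_self]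
  refine Finset.sum_le_sum fun j _ => mul_le_mul_of_nonneg_left ?_ (hP.eigenvalues_nonneg j)
  have h1 := abs_real_inner_le_norm (hP.1.eigenvectorBasis j) (WithLp.toLp 2 v)
  rw [hP.1.eigenvectorBasis.orthonormal.1 j, one_mul] at h1
  rw [← sq_abs]
  exact pow_le_pow_left₀ (abs_nonneg _) h1 2

theorem PosSemidef.l2_opNorm_le_trace {P : Matrix ι ι ℝ} (hP : P.PosSemidef) :
    ‖P‖ ≤ P.trace := by
  have htr : 0 ≤ P.trace := hP.trace_nonneg
  rw [l2_opNorm_def]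
  refine ContinuousLinearMap.opNorm_le_bound _ htr fun v => ?_
  change ‖WithLp.toLp 2 (P *ᵥ v.ofLp)‖ ≤ _
  set u := P *ᵥ v.ofLp with hu
  have h1 := hP.sq_dotProduct_mulVec_le u v.ofLp
  rw [← hu] at h1
  have h2 := hP.dotProduct_mulVec_le_trace u
  have h3 := hP.dotProduct_mulVec_le_trace v.ofLp
  have h4 := hP.dotProduct_mulVec_nonneg v.ofLp
  simp only [star_trivial] at h4
  rw [← hu] at h3 h4
  rw [toLp_dotProduct_self] at h1 h2 h3
  change _ ≤ _ * ‖v‖ ^ 2 at h3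
  set a := ‖WithLp.toLp 2 u‖ with ha
  have ha0 : 0 ≤ a := norm_nonneg _
  by_contra hcon
  rw [not_le] at hcon
  have hpos : 0 < a := lt_of_le_of_lt (by positivity) hcon
  have h5 : (a ^ 2) ^ 2 ≤ (P.trace * a ^ 2) * (P.trace * ‖v‖ ^ 2) :=
    h1.trans (mul_le_mul h2 h3 h4 (by positivity))
  have h6 : (P.trace * ‖v‖) ^ 2 < a ^ 2 := pow_lt_pow_left₀ hcon (by positivity) (by norm_num)
  nlinarith [mul_lt_mul_of_pos_right h6 (pow_pos hpos 2)]

theorem abs_dotProduct_mulVec_le (X : Matrix ι ι ℝ) (v : ι → ℝ) :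
    |v ⬝ᵥ X *ᵥ v| ≤ ‖X‖ * (v ⬝ᵥ v) := by
  have h1 := l2_opNorm_mulVec X (WithLp.toLp 2 v)
  have h2 := abs_real_inner_le_norm (WithLp.toLp 2 v) (WithLp.toLp 2 (X *ᵥ v))
  have h3 : inner ℝ (WithLp.toLp 2 v) (WithLp.toLp 2 (X *ᵥ v)) = v ⬝ᵥ X *ᵥ v := by
    rw [EuclideanSpace.inner_eq_star_dotProduct, dotProduct_comm]
    simp
  rw [h3] at h2
  change ‖WithLp.toLp 2 (X *ᵥ v)‖ ≤ _ at h1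
  rw [toLp_dotProduct_self]
  nlinarith [mul_le_mul_of_nonneg_left h1 (norm_nonneg (WithLp.toLp 2 v))]

theorem abs_trace_le_card_mul_l2_opNorm (X : Matrix ι ι ℝ) :
    |X.trace| ≤ Fintype.card ι * ‖X‖ := by
  have h : ∀ i, |X i i| ≤ ‖X‖ := fun i => by
    have := abs_dotProduct_mulVec_le X (Pi.single i 1)
    simpa using this
  calc |X.trace| ≤ ∑ i, |X i i| := Finset.abs_sum_le_sum_abs _ _
    _ ≤ ∑ _i : ι, ‖X‖ := Finset.sum_le_sum fun i _ => h i
    _ = _ := by simp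

theorem IsHermitian.eq_sum_vecMulVec {A : Matrix ι ι ℝ} (hA : A.IsHermitian) :
    A = ∑ j, hA.eigenvalues j •
      vecMulVec (hA.eigenvectorBasis j).ofLp (hA.eigenvectorBasis j).ofLp := by
  have h := hA.spectral_theorem
  rw [Unitary.conjStarAlgAut_apply] at h
  ext a b
  conv_lhs => rw [h]
  rw [mul_apply]
  simp only [mul_diagonal, sum_apply, smul_apply, vecMulVec_apply, smul_eq_mul,
    star_apply, eigenvectorUnitary_apply, star_trivial, Function.comp_apply,
    RCLike.ofReal_real_eq_id, id_eq]
  refine Finset.sum_congr rfl fun j _ => ?_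
  ring

theorem PosSemidef.trace_mul_nonneg {P X : Matrix ι ι ℝ} (hP : P.PosSemidef)
    (hX : X.PosSemidef) : 0 ≤ (P * X).trace := by
  conv_rhs => rw [hX.1.eq_sum_vecMulVec]
  rw [Finset.mul_sum, trace_sum]
  refine Finset.sum_nonneg fun j _ => ?_
  rw [Matrix.mul_smul, trace_smul, trace_mul_vecMulVec, smul_eq_mul]
  have := hP.dotProduct_mulVec_nonneg (hX.1.eigenvectorBasis j).ofLp
  simp only [star_trivial] at this
  exact mul_nonneg (hX.eigenvalues_nonneg j) this

/-- Cauchy–Schwarz for `P` at the vectors eᵢ and M eᵢ. -/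
theorem one_le_mul_diag_of_mul_eq_one {M P : Matrix ι ι ℝ} (hP : P.PosSemidef) (hPM : P * M = 1)
    (i : ι) : 1 ≤ P i i * M i i := by
  have h := hP.sq_dotProduct_mulVec_le (Pi.single i 1) (M *ᵥ Pi.single i 1)
  rw [mulVec_mulVec, hPM, one_mulVec, dotProduct_comm (M *ᵥ Pi.single i 1)] at h
  simpa using h

/-- Cauchy–Schwarz for M⁻¹ at x and Mx gives M ≥ 1/p, while E ≤ e ≤ 1/(2p). -/
theorem PosDef.posDef_sub {M E : Matrix ι ι ℝ} (hM : M.PosDef) (hE : E.IsHermitian) {p e : ℝ}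
    (hp : 0 < p) (htr : M⁻¹.trace ≤ p) (he : ‖E‖ ≤ e) (hpe : p * e ≤ 1 / 2) :
    (M - E).PosDef := by
  refine PosDef.of_dotProduct_mulVec_pos (hM.1.sub hE) fun x hx => ?_
  have hu : IsUnit M.det := (isUnit_iff_isUnit_det _).1 hM.isUnit
  have hP := hM.inv.posSemidef
  have hxx : 0 < x ⬝ᵥ x := by
    rw [toLp_dotProduct_self]
    have : WithLp.toLp 2 x ≠ 0 := by simpa using hx
    positivity
  have h1 := hP.sq_dotProduct_mulVec_le x (M *ᵥ x)
  rw [mulVec_mulVec, nonsing_inv_mul _ hu, one_mulVec, dotProduct_comm (M *ᵥ x)] at h1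
  have h2 := hP.dotProduct_mulVec_le_trace x
  have h3 := hM.posSemidef.dotProduct_mulVec_nonneg x
  simp only [star_trivial] at h3
  have h4 := abs_le.1 (abs_dotProduct_mulVec_le E x)
  have h5 : x ⬝ᵥ x ≤ p * (x ⬝ᵥ M *ᵥ x) := by
    have : (x ⬝ᵥ x) ^ 2 ≤ (p * (x ⬝ᵥ x)) * (x ⬝ᵥ M *ᵥ x) :=
      h1.trans (mul_le_mul_of_nonneg_right (h2.trans (by gcongr)) h3)
    nlinarith
  rw [star_trivial, sub_mulVec, dotProduct_sub]
  have h6 : x ⬝ᵥ E *ᵥ x ≤ e * (x ⬝ᵥ x) := h4.2.trans (by gcongr)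
  have h7 : p * (x ⬝ᵥ E *ᵥ x) ≤ 1 / 2 * (x ⬝ᵥ x) := by
    calc p * (x ⬝ᵥ E *ᵥ x) ≤ p * (e * (x ⬝ᵥ x)) := by gcongr
      _ = p * e * (x ⬝ᵥ x) := by ring
      _ ≤ _ := by gcongr
  by_contra hcon
  rw [not_lt] at hcon
  nlinarith

/-- The resolvent identity R = P + PER, iterated, leaves the remainder (PE)³R. The same identity
with ‖PE‖ ≤ 1/2 gives ‖R‖ ≤ 2p. -/
theorem PosDef.trace_inv_sub_le {M E : Matrix ι ι ℝ} (hM : M.PosDef) (hE : E.IsHermitian) {p e : ℝ}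
    (hp : 0 < p) (htr : M⁻¹.trace ≤ p) (he : ‖E‖ ≤ e) (hpe : p * e ≤ 1 / 2) :
    (M - E)⁻¹.trace ≤ M⁻¹.trace + (M⁻¹ * E * M⁻¹).trace + (M⁻¹ * E * M⁻¹ * E * M⁻¹).trace +
      Fintype.card ι * (2 * p ^ 4 * e ^ 3) := by
  have hu : IsUnit M.det := (isUnit_iff_isUnit_det _).1 hM.isUnit
  have hu' : IsUnit (M - E).det :=
    (isUnit_iff_isUnit_det _).1 (hM.posDef_sub hE hp htr he hpe).isUnit
  set P := M⁻¹ with hP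
  set R := (M - E)⁻¹ with hR
  have hPn : ‖P‖ ≤ p := hM.inv.posSemidef.l2_opNorm_le_trace.trans htr
  have he0 : 0 ≤ e := (norm_nonneg _).trans he
  have hPM : P * M = 1 := nonsing_inv_mul _ hu
  have hMR : (M - E) * R = 1 := mul_nonsing_inv _ hu'
  have hid : R = P + P * E * R := by
    have h1 : P * ((M - E) * R) = R - P * E * R := by
      rw [← Matrix.mul_assoc, Matrix.mul_sub, hPM, Matrix.sub_mul, Matrix.one_mul]
    rw [hMR, Matrix.mul_one] at h1
    exact (eq_sub_iff_add_eq.1 h1).symm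
  have hPE : ‖P * E‖ ≤ p * e := (norm_mul_le _ _).trans (mul_le_mul hPn he (norm_nonneg _) hp.le)
  have hRn : ‖R‖ ≤ 2 * p := by
    have h1 : ‖R‖ ≤ p + 1 / 2 * ‖R‖ := by
      calc ‖R‖ = ‖P + P * E * R‖ := by rw [← hid]
        _ ≤ ‖P‖ + ‖P * E * R‖ := norm_add_le _ _
        _ ≤ ‖P‖ + ‖P * E‖ * ‖R‖ := by gcongr; exact norm_mul_le _ _
        _ ≤ p + 1 / 2 * ‖R‖ := by gcongr; exact hPE.trans hpe
    linarith
  have hexp : R = P + P * E * P + P * E * P * E * P + P * E * (P * E) * (P * E) * R := by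
    have h2 : P * E * P * E * P + P * E * (P * E) * (P * E) * R = P * E * (P * E * R) := by
      conv_rhs => rw [hid]
      simp only [Matrix.mul_add, Matrix.mul_assoc]
    have h3 : P * E * P + P * E * (P * E * R) = P * E * R := by
      conv_rhs => rw [hid]
      simp only [Matrix.mul_add, Matrix.mul_assoc]
    rw [add_assoc, h2, add_assoc, h3, ← hid]
  have hlast : ‖P * E * (P * E) * (P * E) * R‖ ≤ 2 * p ^ 4 * e ^ 3 := by
    calc ‖P * E * (P * E) * (P * E) * R‖ ≤ ‖P * E‖ * ‖P * E‖ * ‖P * E‖ * ‖R‖ := by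
          refine (norm_mul_le _ _).trans (mul_le_mul_of_nonneg_right ?_ (norm_nonneg _))
          refine (norm_mul_le _ _).trans (mul_le_mul_of_nonneg_right ?_ (norm_nonneg _))
          exact norm_mul_le _ _
      _ ≤ (p * e) * (p * e) * (p * e) * (2 * p) := by gcongr
      _ = _ := by ring
  have htr3 := (le_abs_self _).trans
    (abs_trace_le_card_mul_l2_opNorm (P * E * (P * E) * (P * E) * R))
  have htr4 : (Fintype.card ι : ℝ) * ‖P * E * (P * E) * (P * E) * R‖ ≤
      Fintype.card ι * (2 * p ^ 4 * e ^ 3) := by gcongr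
  conv_lhs => rw [hexp]
  simp only [trace_add]
  linarith

/-- The third-order error bound for `tr (M + β r² - r B)⁻¹` is this constant times `r ^ 3`. -/
def barrierErrorConst (N p L β : ℝ) : ℝ :=
  N * (2 * β * L * p ^ 3 + β ^ 2 * p ^ 3 + 2 * p ^ 4 * (L + β) ^ 3)

/-- The expansion applied to E = rB - βr²·1. The barrier rise is of order r², so its first-order
effect competes with the second-order effect of B; everything else is O(r³). -/
theorem PosDef.barrier_shift {M B : Matrix ι ι ℝ} (hM : M.PosDef) (hB : B.IsHermitian)
    {p L β r : ℝ} (hp : 0 < p) (htr : M⁻¹.trace ≤ p) (hL : ‖B‖ ≤ L) (hβ : 0 ≤ β) (hr0 : 0 ≤ r)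
    (hr1 : r ≤ 1) (hpr : p * (r * (L + β)) ≤ 1 / 2) :
    (M + (β * r ^ 2) • (1 : Matrix ι ι ℝ) - r • B).PosDef ∧
      (M + (β * r ^ 2) • (1 : Matrix ι ι ℝ) - r • B)⁻¹.trace ≤
        M⁻¹.trace + r * (M⁻¹ * B * M⁻¹).trace - β * r ^ 2 * (M⁻¹ * M⁻¹).trace +
          r ^ 2 * (M⁻¹ * B * M⁻¹ * B * M⁻¹).trace +
          barrierErrorConst (Fintype.card ι) p L β * r ^ 3 := by
  set P := M⁻¹ with hP
  set η := β * r ^ 2 with hη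
  set E := r • B - η • (1 : Matrix ι ι ℝ) with hE
  have hη0 : 0 ≤ η := by positivity
  have hL0 : 0 ≤ L := (norm_nonneg _).trans hL
  have hone : ‖(1 : Matrix ι ι ℝ)‖ ≤ 1 := by
    rw [l2_opNorm_def]
    refine ContinuousLinearMap.opNorm_le_bound _ zero_le_one fun v => ?_
    change ‖WithLp.toLp 2 ((1 : Matrix ι ι ℝ) *ᵥ v.ofLp)‖ ≤ _
    rw [one_mulVec, one_mul]
  have hEh : E.IsHermitian := by
    refine IsHermitian.sub ?_ ?_
    · rw [IsHermitian, conjTranspose_smul, hB.eq, star_trivial]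
    · simp [IsHermitian]
  have hEn : ‖E‖ ≤ r * (L + β) := by
    calc ‖E‖ ≤ ‖r • B‖ + ‖η • (1 : Matrix ι ι ℝ)‖ := norm_sub_le _ _
      _ = r * ‖B‖ + η * ‖(1 : Matrix ι ι ℝ)‖ := by
          rw [norm_smul, norm_smul, Real.norm_of_nonneg hr0, Real.norm_of_nonneg hη0]
      _ ≤ r * L + η * 1 := by gcongr
      _ ≤ r * (L + β) := by
          rw [hη]
          nlinarith [mul_le_mul_of_nonneg_left hr1 (mul_nonneg hβ hr0)]
  have hME : M + η • (1 : Matrix ι ι ℝ) - r • B = M - E := by rw [hE]; abel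
  rw [hME]
  refine ⟨hM.posDef_sub hEh hp htr hEn hpr, ?_⟩
  refine (hM.trace_inv_sub_le hEh hp htr hEn hpr).trans ?_
  rw [← hP]
  have h1 : (P * E * P).trace = r * (P * B * P).trace - η * (P * P).trace := by
    rw [hE]
    simp [Matrix.mul_sub, Matrix.sub_mul, trace_sub]
  have h2 : P * E * P * E * P = r ^ 2 • (P * B * P * B * P) -
      (η * r) • (P * B * P * P + P * P * B * P) + η ^ 2 • (P * P * P) := by
    rw [hE]
    simp only [Matrix.mul_sub, Matrix.sub_mul, Matrix.mul_smul, Matrix.smul_mul, Matrix.mul_one,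
      smul_sub, smul_smul, smul_add, sq]
    rw [mul_comm r η]
    abel
  have hPn : ‖P‖ ≤ p := hM.inv.posSemidef.l2_opNorm_le_trace.trans htr
  have hn1 : ‖P * B * P * P‖ ≤ p * L * p * p := by
    refine (norm_mul_le _ _).trans (mul_le_mul ?_ hPn (norm_nonneg _) (by positivity))
    refine (norm_mul_le _ _).trans (mul_le_mul ?_ hPn (norm_nonneg _) (by positivity))
    exact (norm_mul_le _ _).trans (mul_le_mul hPn hL (norm_nonneg _) (by positivity))
  have hn2 : ‖P * P * B * P‖ ≤ p * p * L * p := by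
    refine (norm_mul_le _ _).trans (mul_le_mul ?_ hPn (norm_nonneg _) (by positivity))
    refine (norm_mul_le _ _).trans (mul_le_mul ?_ hL (norm_nonneg _) (by positivity))
    exact (norm_mul_le _ _).trans (mul_le_mul hPn hPn (norm_nonneg _) (by positivity))
  have hn3 : ‖P * P * P‖ ≤ p * p * p := by
    refine (norm_mul_le _ _).trans (mul_le_mul ?_ hPn (norm_nonneg _) (by positivity))
    exact (norm_mul_le _ _).trans (mul_le_mul hPn hPn (norm_nonneg _) (by positivity))
  set N : ℝ := ((Fintype.card ι : ℕ) : ℝ) with hN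
  have hN0 : 0 ≤ N := by positivity
  have ht1 := (abs_le.1 (abs_trace_le_card_mul_l2_opNorm (P * B * P * P))).1
  have ht2 := (abs_le.1 (abs_trace_le_card_mul_l2_opNorm (P * P * B * P))).1
  have ht3 := (abs_le.1 (abs_trace_le_card_mul_l2_opNorm (P * P * P))).2
  rw [← hN] at ht1 ht2 ht3
  have hq1 : -(N * (p * L * p * p)) ≤ (P * B * P * P).trace := by
    linarith [mul_le_mul_of_nonneg_left hn1 hN0]
  have hq2 : -(N * (p * p * L * p)) ≤ (P * P * B * P).trace := by
    linarith [mul_le_mul_of_nonneg_left hn2 hN0]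
  have hq3 : (P * P * P).trace ≤ N * (p * p * p) := by
    linarith [mul_le_mul_of_nonneg_left hn3 hN0]
  have hηr : 0 ≤ η * r := by positivity
  have hs : (P * E * P * E * P).trace ≤ r ^ 2 * (P * B * P * B * P).trace +
      η * r * (N * (p * L * p * p) + N * (p * p * L * p)) + η ^ 2 * (N * (p * p * p)) := by
    rw [h2]
    simp only [trace_add, trace_sub, trace_smul, smul_eq_mul]
    have := mul_le_mul_of_nonneg_left (add_le_add hq1 hq2) hηr
    have := mul_le_mul_of_nonneg_left hq3 (sq_nonneg η)
    linarith
  have hη2 : η ^ 2 * (N * (p * p * p)) ≤ β ^ 2 * r ^ 3 * (N * (p * p * p)) := by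
    refine mul_le_mul_of_nonneg_right ?_ (by positivity)
    rw [hη, mul_pow]
    refine mul_le_mul_of_nonneg_left ?_ (sq_nonneg _)
    rw [← pow_mul]
    exact pow_le_pow_of_le_one hr0 hr1 (by norm_num)
  rw [h1]
  unfold barrierErrorConst
  have : η * r = β * r ^ 3 := by rw [hη]; ring
  rw [this] at hs
  have e1 : N * (2 * p ^ 4 * (r * (L + β)) ^ 3) = N * (2 * p ^ 4 * (L + β) ^ 3) * r ^ 3 := by ring
  rw [e1]
  nlinarith [hs, hη2]

end Matrix

end MatrixEstimates

/-! ### Trace bounds through absolute values. -/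

section MatrixFamily

open Matrix

theorem trace_mul_symmAbs {n : ℕ} {A : Matrix (Fin n) (Fin n) ℝ} (hA : A.IsHermitian)
    (P : Matrix (Fin n) (Fin n) ℝ) :
    (P * symmAbs hA).trace = ∑ j, |hA.eigenvalues j| *
      ((hA.eigenvectorBasis j).ofLp ⬝ᵥ P *ᵥ (hA.eigenvectorBasis j).ofLp) := by
  rw [symmAbs, Finset.mul_sum, trace_sum]
  refine Finset.sum_congr rfl fun j _ => ?_
  rw [Matrix.mul_smul, trace_smul, trace_mul_vecMulVec, smul_eq_mul]

theorem trace_mul_symmAbs_nonneg {n : ℕ} {A : Matrix (Fin n) (Fin n) ℝ} (hA : A.IsHermitian)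
    {P : Matrix (Fin n) (Fin n) ℝ} (hP : P.PosSemidef) : 0 ≤ (P * symmAbs hA).trace := by
  rw [trace_mul_symmAbs]
  refine Finset.sum_nonneg fun j _ => mul_nonneg (abs_nonneg _) ?_
  simpa using hP.dotProduct_mulVec_nonneg (hA.eigenvectorBasis j).ofLp

/-- In an eigenbasis of A the left side is ∑ μⱼμₖ Pⱼₖ Wₖⱼ. Cauchy–Schwarz for P and W, then AM–GM,
bound |Pⱼₖ Wₖⱼ| by (Pⱼⱼ Wₖₖ + Pₖₖ Wⱼⱼ)/2, and the double sum factors. -/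
theorem trace_mul_mul_mul_le_mul_trace_symmAbs {n : ℕ} {A P W : Matrix (Fin n) (Fin n) ℝ}
    (hA : A.IsHermitian) (hP : P.PosSemidef) (hW : W.PosSemidef) :
    (W * A * P * A).trace ≤ (P * symmAbs hA).trace * (W * symmAbs hA).trace := by
  set v := fun j => (hA.eigenvectorBasis j).ofLp with hv
  set μ := hA.eigenvalues with hμ
  have hexp : (W * A * P * A).trace =
      ∑ j, ∑ k, (μ j * μ k) * ((v j ⬝ᵥ P *ᵥ v k) * (v k ⬝ᵥ W *ᵥ v j)) := by
    have h0 : W * A * P * A = ∑ j, ∑ k, (μ j * μ k) •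
        (W * vecMulVec (v j) (v j) * P * vecMulVec (v k) (v k)) := by
      conv_lhs => rw [hA.eq_sum_vecMulVec]
      simp only [Finset.mul_sum, Finset.sum_mul, Matrix.mul_smul, Matrix.smul_mul, smul_smul]
      rw [Finset.sum_comm]
      exact Finset.sum_congr rfl fun j _ => Finset.sum_congr rfl fun k _ => by
        rw [mul_comm]
    rw [h0, trace_sum]
    refine Finset.sum_congr rfl fun j _ => ?_
    rw [trace_sum]
    refine Finset.sum_congr rfl fun k _ => ?_
    rw [trace_smul, smul_eq_mul, trace_mul_vecMulVec, mul_vecMulVec, vecMulVec_mul,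
      vecMulVec_mulVec, ← dotProduct_mulVec]
    simp
  have hp : ∀ j, 0 ≤ v j ⬝ᵥ P *ᵥ v j := fun j => by
    simpa using hP.dotProduct_mulVec_nonneg (v j)
  have hq : ∀ j, 0 ≤ v j ⬝ᵥ W *ᵥ v j := fun j => by
    simpa using hW.dotProduct_mulVec_nonneg (v j)
  have hterm : ∀ j k, (μ j * μ k) * ((v j ⬝ᵥ P *ᵥ v k) * (v k ⬝ᵥ W *ᵥ v j)) ≤
      (|μ j| * |μ k|) * (((v j ⬝ᵥ P *ᵥ v j) * (v k ⬝ᵥ W *ᵥ v k) +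
        (v k ⬝ᵥ P *ᵥ v k) * (v j ⬝ᵥ W *ᵥ v j)) / 2) := by
    intro j k
    refine (le_abs_self _).trans ?_
    rw [abs_mul, abs_mul]
    refine mul_le_mul_of_nonneg_left ?_ (by positivity)
    have h1 := hP.sq_dotProduct_mulVec_le (v j) (v k)
    have h2 := hW.sq_dotProduct_mulVec_le (v k) (v j)
    have := hp j
    have := hp k
    have := hq j
    have := hq k
    refine abs_le_of_sq_le_sq ?_ (by positivity)
    have h3 := mul_le_mul h1 h2 (sq_nonneg _) (by positivity)
    rw [mul_pow]
    refine h3.trans ?_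
    nlinarith [sq_nonneg ((v j ⬝ᵥ P *ᵥ v j) * (v k ⬝ᵥ W *ᵥ v k) -
        (v k ⬝ᵥ P *ᵥ v k) * (v j ⬝ᵥ W *ᵥ v j))]
  rw [hexp, trace_mul_symmAbs, trace_mul_symmAbs]
  refine (Finset.sum_le_sum fun j _ => Finset.sum_le_sum fun k _ => hterm j k).trans (le_of_eq ?_)
  have hsplit : ∀ j k, (|μ j| * |μ k|) * (((v j ⬝ᵥ P *ᵥ v j) * (v k ⬝ᵥ W *ᵥ v k) +
        (v k ⬝ᵥ P *ᵥ v k) * (v j ⬝ᵥ W *ᵥ v j)) / 2) =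
      (|μ j| * (v j ⬝ᵥ P *ᵥ v j)) * (|μ k| * (v k ⬝ᵥ W *ᵥ v k)) / 2 +
      (|μ j| * (v j ⬝ᵥ W *ᵥ v j)) * (|μ k| * (v k ⬝ᵥ P *ᵥ v k)) / 2 := fun j k => by ring
  simp_rw [hsplit, Finset.sum_add_distrib, ← Finset.sum_div, ← Finset.sum_mul_sum]
  ring

/-- The Loewner bound on ∑ |Aᵢ| enters the argument here, paired with `P`; it is later used for the
inverses and for their squares. -/
theorem sum_trace_mul_symmAbs_le {n m : ℕ} {A : Fin m → Matrix (Fin n) (Fin n) ℝ}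
    (hA : ∀ i, (A i).IsHermitian) (hsum : ∑ i, symmAbs (hA i) ≤ 1)
    {P : Matrix (Fin n) (Fin n) ℝ} (hP : P.PosSemidef) :
    ∑ i, (P * symmAbs (hA i)).trace ≤ P.trace := by
  have h := hP.trace_mul_nonneg (Matrix.le_iff.1 hsum)
  rw [Matrix.mul_sub, Matrix.mul_one, trace_sub, Finset.mul_sum, trace_sum] at h
  linarith

/-- The Gram matrix of the quadratic form `x ↦ tr (P S P S P)`, where `S = ∑ᵢ xᵢ Aᵢ`. -/
def barrierGram {n m : ℕ} (A : Fin m → Matrix (Fin n) (Fin n) ℝ) (P : Matrix (Fin n) (Fin n) ℝ) :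
    Matrix (Fin m) (Fin m) ℝ :=
  of fun i k => (P * A i * P * A k * P).trace

theorem dotProduct_barrierGram_mulVec {n m : ℕ} (A : Fin m → Matrix (Fin n) (Fin n) ℝ)
    (P : Matrix (Fin n) (Fin n) ℝ) (x : Fin m → ℝ) :
    x ⬝ᵥ barrierGram A P *ᵥ x =
      (P * (∑ i, x i • A i) * P * (∑ i, x i • A i) * P).trace := by
  simp only [Finset.mul_sum, Finset.sum_mul, Matrix.mul_smul, Matrix.smul_mul, smul_smul,
    trace_sum, trace_smul, smul_eq_mul, dotProduct, mulVec, barrierGram, of_apply]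
  rw [Finset.sum_comm]
  exact Finset.sum_congr rfl fun i _ => Finset.sum_congr rfl fun k _ => by ring

theorem isHermitian_sum_smul {n m : ℕ} {A : Fin m → Matrix (Fin n) (Fin n) ℝ}
    (hA : ∀ i, (A i).IsHermitian) (x : Fin m → ℝ) : (∑ i, x i • A i).IsHermitian := by
  rw [IsHermitian, conjTranspose_sum]
  exact Finset.sum_congr rfl fun i _ => by
    rw [conjTranspose_smul, (hA i).eq, star_trivial]

theorem posSemidef_barrierGram {n m : ℕ} {A : Fin m → Matrix (Fin n) (Fin n) ℝ}
    (hA : ∀ i, (A i).IsHermitian) {P : Matrix (Fin n) (Fin n) ℝ} (hP : P.PosSemidef) :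
    (barrierGram A P).PosSemidef := by
  refine PosSemidef.of_dotProduct_mulVec_nonneg ?_ fun x => ?_
  · ext i k
    rw [conjTranspose_apply, star_trivial, barrierGram, of_apply, of_apply,
      ← star_trivial (P * A k * P * A i * P).trace, ← trace_conjTranspose]
    simp only [conjTranspose_mul, hP.1.eq, (hA _).eq, Matrix.mul_assoc]
  · rw [star_trivial, dotProduct_barrierGram_mulVec]
    exact hP.trace_conj_mul_conj_nonneg (isHermitian_sum_smul hA x)

theorem barrierGram_apply_self_le {n m : ℕ} {A : Fin m → Matrix (Fin n) (Fin n) ℝ}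
    (hA : ∀ i, (A i).IsHermitian) {P : Matrix (Fin n) (Fin n) ℝ} (hP : P.PosSemidef) (i : Fin m) :
    barrierGram A P i i ≤ (P * symmAbs (hA i)).trace * (P * P * symmAbs (hA i)).trace := by
  refine le_of_eq_of_le ?_ (trace_mul_mul_mul_le_mul_trace_symmAbs (hA i) hP hP.mul_self)
  rw [barrierGram, of_apply, trace_mul_comm]
  simp only [Matrix.mul_assoc]

theorem exists_submodule_barrier {n m : ℕ} (hm : 100 ≤ m) {A : Fin m → Matrix (Fin n) (Fin n) ℝ}
    (hA : ∀ i, (A i).IsHermitian) (hsum : ∑ i, symmAbs (hA i) ≤ 1)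
    {P N : Matrix (Fin n) (Fin n) ℝ} (hP : P.PosSemidef) (hN : N.PosSemidef) {Φ : ℝ}
    (hΦ0 : 0 < Φ) (hΦ : P.trace + N.trace ≤ Φ) (hS : 0 < (P * P).trace + (N * N).trace) :
    ∃ V : Submodule ℝ (EuclideanSpace ℝ (Fin m)),
      49 / 100 * (m : ℝ) ≤ Module.finrank ℝ V ∧
      ∀ y ∈ V, (P * (∑ i, y i • A i) * P).trace = (N * (∑ i, y i • A i) * N).trace ∧
        (P * (∑ i, y i • A i) * P * (∑ i, y i • A i) * P).trace +
          (N * (∑ i, y i • A i) * N * (∑ i, y i • A i) * N).trace ≤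
        16 * Φ * ((P * P).trace + (N * N).trace) / (m : ℝ) ^ 2 * ‖y‖ ^ 2 := by
  have hPP := hP.mul_self
  have hNN := hN.mul_self
  obtain ⟨V, hV, hVy⟩ := exists_submodule_quadForm_le hm
    ((posSemidef_barrierGram hA hP).add (posSemidef_barrierGram hA hN))
    (a := fun i => (P * symmAbs (hA i)).trace + (N * symmAbs (hA i)).trace)
    (c := fun i => (P * P * symmAbs (hA i)).trace + (N * N * symmAbs (hA i)).trace)
    (fun i => add_nonneg (trace_mul_symmAbs_nonneg _ hP) (trace_mul_symmAbs_nonneg _ hN))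
    (fun i => add_nonneg (trace_mul_symmAbs_nonneg _ hPP) (trace_mul_symmAbs_nonneg _ hNN))
    hΦ0 hS
    (by
      rw [Finset.sum_add_distrib]
      exact (add_le_add (sum_trace_mul_symmAbs_le hA hsum hP)
        (sum_trace_mul_symmAbs_le hA hsum hN)).trans hΦ)
    (by
      rw [Finset.sum_add_distrib]
      exact add_le_add (sum_trace_mul_symmAbs_le hA hsum hPP)
        (sum_trace_mul_symmAbs_le hA hsum hNN))
    (fun i => by
      rw [Matrix.add_apply]
      have h1 := barrierGram_apply_self_le hA hP i
      have h2 := barrierGram_apply_self_le hA hN i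
      -- The mixed products in aᵢcᵢ are nonnegative and can be dropped.
      have := mul_nonneg (trace_mul_symmAbs_nonneg (hA i) hP) (trace_mul_symmAbs_nonneg (hA i) hNN)
      have := mul_nonneg (trace_mul_symmAbs_nonneg (hA i) hN) (trace_mul_symmAbs_nonneg (hA i) hPP)
      linarith)
    -- Orthogonality to this vector makes the first-order changes of the two traces cancel.
    (WithLp.toLp 2 fun i => (P * A i * P).trace - (N * A i * N).trace)
  refine ⟨V, hV, fun y hy => ?_⟩
  obtain ⟨h1, h2⟩ := hVy y hy
  constructor
  · rw [EuclideanSpace.inner_eq_star_dotProduct, star_trivial] at h1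
    simp only [dotProduct, mul_sub, Finset.sum_sub_distrib] at h1
    simp only [Finset.mul_sum, Finset.sum_mul, Matrix.mul_smul, Matrix.smul_mul,
      trace_sum, trace_smul, smul_eq_mul]
    linarith
  · rwa [add_mulVec, dotProduct_add, dotProduct_barrierGram_mulVec,
      dotProduct_barrierGram_mulVec] at h2

end MatrixFamily

/-! ### The barrier potential along one step. -/

section BarrierWalk

open Matrix

variable {n m : ℕ}

/-- The matrices `b - ∑ᵢ xᵢ Aᵢ` and `b + ∑ᵢ xᵢ Aᵢ` are positive definite, and the traces of their
inverses add up to at most `Φ`. -/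
def BarrierBound (A : Fin m → Matrix (Fin n) (Fin n) ℝ) (Φ b : ℝ)
    (x : EuclideanSpace ℝ (Fin m)) : Prop :=
  (b • (1 : Matrix (Fin n) (Fin n) ℝ) - ∑ i, x i • A i).PosDef ∧
    (b • (1 : Matrix (Fin n) (Fin n) ℝ) + ∑ i, x i • A i).PosDef ∧
      (b • (1 : Matrix (Fin n) (Fin n) ℝ) - ∑ i, x i • A i)⁻¹.trace +
        (b • (1 : Matrix (Fin n) (Fin n) ℝ) + ∑ i, x i • A i)⁻¹.trace ≤ Φ

theorem sum_add_smul_smul (A : Fin m → Matrix (Fin n) (Fin n) ℝ)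
    (x y : EuclideanSpace ℝ (Fin m)) (r : ℝ) :
    ∑ i, (x + r • y) i • A i = ∑ i, x i • A i + r • ∑ i, y i • A i := by
  rw [Finset.smul_sum, ← Finset.sum_add_distrib]
  refine Finset.sum_congr rfl fun i _ => ?_
  rw [PiLp.add_apply, PiLp.smul_apply, smul_eq_mul, add_smul, smul_smul]

theorem norm_sum_smul_le (A : Fin m → Matrix (Fin n) (Fin n) ℝ)
    (y : EuclideanSpace ℝ (Fin m)) : ‖∑ i, y i • A i‖ ≤ ‖y‖ * ∑ i, ‖A i‖ := by
  refine (norm_sum_le _ _).trans ?_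
  rw [Finset.mul_sum]
  refine Finset.sum_le_sum fun i _ => ?_
  rw [norm_smul]
  exact mul_le_mul_of_nonneg_right (PiLp.norm_apply_le y i) (norm_nonneg _)

/-- U = ε - S and W = ε + S commute, so UWU + WUW = UW(U + W) = 2ε(ε² - S²), and the left side is
visibly positive semidefinite. -/
theorem l2_opNorm_le_of_posSemidef_sub_add {S : Matrix (Fin n) (Fin n) ℝ} (hS : S.IsHermitian)
    {ε : ℝ} (hε : 0 < ε) (h1 : (ε • (1 : Matrix (Fin n) (Fin n) ℝ) - S).PosSemidef)
    (h2 : (ε • (1 : Matrix (Fin n) (Fin n) ℝ) + S).PosSemidef) : ‖S‖ ≤ ε := by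
  set U := ε • (1 : Matrix (Fin n) (Fin n) ℝ) - S with hU
  set W := ε • (1 : Matrix (Fin n) (Fin n) ℝ) + S with hW
  have hsum : U * W * U + W * U * W =
      (2 * ε) • (ε ^ 2 • (1 : Matrix (Fin n) (Fin n) ℝ) - S * S) := by
    rw [hU, hW]
    simp only [Matrix.mul_sub, Matrix.sub_mul, Matrix.mul_add, Matrix.add_mul, Matrix.mul_smul,
      Matrix.smul_mul, Matrix.mul_one, Matrix.one_mul, smul_sub, smul_add, smul_smul]
    module
  have hpsd : (U * W * U + W * U * W).PosSemidef := by
    have h3 := h2.mul_mul_conjTranspose_same U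
    have h4 := h1.mul_mul_conjTranspose_same W
    rw [h1.1.eq] at h3
    rw [h2.1.eq] at h4
    exact h3.add h4
  rw [hsum] at hpsd
  rw [l2_opNorm_def]
  refine ContinuousLinearMap.opNorm_le_bound _ hε.le fun v => ?_
  change ‖WithLp.toLp 2 (S *ᵥ v.ofLp)‖ ≤ _
  have h5 := hpsd.dotProduct_mulVec_nonneg v.ofLp
  have h6 : v.ofLp ⬝ᵥ (S * S) *ᵥ v.ofLp = ‖WithLp.toLp 2 (S *ᵥ v.ofLp)‖ ^ 2 := by
    rw [← toLp_dotProduct_self, ← mulVec_mulVec, hS.dotProduct_mulVec_comm]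
  rw [star_trivial, smul_mulVec, dotProduct_smul, sub_mulVec, dotProduct_sub, h6, smul_mulVec,
    dotProduct_smul, one_mulVec, toLp_dotProduct_self, smul_eq_mul, smul_eq_mul] at h5
  change 0 ≤ 2 * ε * (ε ^ 2 * ‖v‖ ^ 2 - _) at h5
  refine abs_le_of_sq_le_sq' ?_ (by positivity) |>.2
  have := nonneg_of_mul_nonneg_right h5 (by positivity)
  nlinarith

theorem BarrierBound.mem_opNormBody {A : Fin m → Matrix (Fin n) (Fin n) ℝ}
    (hA : ∀ i, (A i).IsHermitian) {Φ ε : ℝ} (hε : 0 < ε) {x : EuclideanSpace ℝ (Fin m)}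
    (h : BarrierBound A Φ ε x) : x ∈ opNormBody A ε :=
  l2_opNorm_le_of_posSemidef_sub_add (isHermitian_sum_smul hA x) hε h.1.posSemidef h.2.1.posSemidef

theorem sq_le_trace_mul_self_of_le_diag {P : Matrix (Fin n) (Fin n) ℝ} (hP : P.PosSemidef) {i : Fin n} {q : ℝ}
    (hq : 0 ≤ q) (hPq : q ≤ P i i) : q ^ 2 ≤ (P * P).trace := by
  have h1 : (P * P).diag i ≤ (P * P).trace :=
    Finset.single_le_sum (f := fun j => (P * P).diag j)
      (fun j _ => hP.mul_self.diag_nonneg) (Finset.mem_univ i)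
  refine le_trans ?_ h1
  have hT : P.transpose = P := by simpa [IsHermitian] using hP.1
  rw [diag_apply, Matrix.mul_apply]
  have h2 : P i i * P i i ≤ ∑ j, P i j * P j i :=
    Finset.single_le_sum (f := fun j => P i j * P j i) (fun j _ => by
      have : P j i = P i j := by conv_lhs => rw [← hT, transpose_apply]
      rw [this]
      exact mul_self_nonneg _) (Finset.mem_univ i)
  nlinarith

/-- Corresponding diagonal entries of the two matrices are positive with sum 2b, so the first is
below 2ε and its inverse has diagonal entry at least 1/(2ε). This floor, uniform along the walk,
lets one step size absorb all cubic errors. -/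
theorem BarrierBound.le_trace_sq {A : Fin m → Matrix (Fin n) (Fin n) ℝ} (hn : 0 < n) {Φ b ε : ℝ}
    (hbε : b ≤ ε) {x : EuclideanSpace ℝ (Fin m)} (h : BarrierBound A Φ b x) :
    0 < ε ∧ (1 / (2 * ε)) ^ 2 ≤
      ((b • (1 : Matrix (Fin n) (Fin n) ℝ) - ∑ i, x i • A i)⁻¹ *
        (b • (1 : Matrix (Fin n) (Fin n) ℝ) - ∑ i, x i • A i)⁻¹).trace +
      ((b • (1 : Matrix (Fin n) (Fin n) ℝ) + ∑ i, x i • A i)⁻¹ *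
        (b • (1 : Matrix (Fin n) (Fin n) ℝ) + ∑ i, x i • A i)⁻¹).trace := by
  obtain ⟨h1, h2, -⟩ := h
  set M := b • (1 : Matrix (Fin n) (Fin n) ℝ) - ∑ i, x i • A i with hM
  set M' := b • (1 : Matrix (Fin n) (Fin n) ℝ) + ∑ i, x i • A i with hM'
  let i : Fin n := ⟨0, hn⟩
  have hsum : M i i + M' i i = 2 * b := by
    rw [hM, hM', Matrix.sub_apply, Matrix.add_apply, Matrix.smul_apply, Matrix.one_apply_eq,
      smul_eq_mul]
    ring
  have hp1 : 0 < M i i := h1.diag_pos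
  have hp2 : 0 < M' i i := h2.diag_pos
  have hε : 0 < ε := by linarith
  refine ⟨hε, ?_⟩
  have hPM : M⁻¹ * M = 1 := nonsing_inv_mul _ ((isUnit_iff_isUnit_det _).1 h1.isUnit)
  have h3 := one_le_mul_diag_of_mul_eq_one h1.inv.posSemidef hPM i
  have h4 : 1 / (2 * ε) ≤ M⁻¹ i i := by
    rw [div_le_iff₀ (by positivity)]
    have : 0 < M⁻¹ i i := h1.inv.diag_pos
    nlinarith
  have h5 := sq_le_trace_mul_self_of_le_diag h1.inv.posSemidef (by positivity) h4
  have h6 := h2.inv.posSemidef.mul_self.trace_nonneg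
  linarith

/-- First-order terms cancel between the two inverses. Of the decrease βr²(tr P² + tr N²) due to the
barrier rise, half pays for the second-order terms and half for the two cubic errors. -/
theorem BarrierBound.step {A : Fin m → Matrix (Fin n) (Fin n) ℝ} (hA : ∀ i, (A i).IsHermitian)
    {Φ b β L s r : ℝ} {x y : EuclideanSpace ℝ (Fin m)} (h : BarrierBound A Φ b x) (hΦ : 0 < Φ)
    (hβ : 0 ≤ β) (hL : ‖∑ i, y i • A i‖ ≤ L) {P N : Matrix (Fin n) (Fin n) ℝ}
    (hP : P = (b • (1 : Matrix (Fin n) (Fin n) ℝ) - ∑ i, x i • A i)⁻¹)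
    (hN : N = (b • (1 : Matrix (Fin n) (Fin n) ℝ) + ∑ i, x i • A i)⁻¹)
    (hlin : (P * (∑ i, y i • A i) * P).trace = (N * (∑ i, y i • A i) * N).trace)
    (hquad : (P * (∑ i, y i • A i) * P * (∑ i, y i • A i) * P).trace +
          (N * (∑ i, y i • A i) * N * (∑ i, y i • A i) * N).trace ≤
        β / 2 * ((P * P).trace + (N * N).trace))
    (hs : s ≤ (P * P).trace + (N * N).trace)
    (hr0 : 0 ≤ r) (hr1 : r ≤ 1) (hr2 : Φ * (r * (L + β)) ≤ 1 / 2)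
    (hr3 : 2 * barrierErrorConst n Φ L β * r ≤ β / 2 * s) :
    BarrierBound A Φ (b + β * r ^ 2) (x + r • y) := by
  obtain ⟨h1, h2, h3⟩ := h
  have hB := isHermitian_sum_smul hA y
  rw [← hP, ← hN] at h3
  have hP0 : 0 ≤ P.trace := hP ▸ h1.inv.posSemidef.trace_nonneg
  have hN0 : 0 ≤ N.trace := hN ▸ h2.inv.posSemidef.trace_nonneg
  obtain ⟨k1, k2⟩ := h1.barrier_shift hB hΦ (by rw [← hP]; linarith) hL hβ hr0 hr1 hr2
  obtain ⟨l1, l2⟩ := h2.barrier_shift hB.neg hΦ (by rw [← hN]; linarith)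
    ((norm_neg _).trans_le hL) hβ hr0 hr1 hr2
  rw [← hP] at k2
  rw [← hN] at l2
  set B := ∑ i, y i • A i with hBdef
  have e1 : b • (1 : Matrix (Fin n) (Fin n) ℝ) - ∑ i, x i • A i + (β * r ^ 2) • 1 - r • B =
      (b + β * r ^ 2) • (1 : Matrix (Fin n) (Fin n) ℝ) - ∑ i, (x + r • y) i • A i := by
    rw [sum_add_smul_smul, add_smul]
    abel
  have e2 : b • (1 : Matrix (Fin n) (Fin n) ℝ) + ∑ i, x i • A i + (β * r ^ 2) • 1 - r • -B =
      (b + β * r ^ 2) • (1 : Matrix (Fin n) (Fin n) ℝ) + ∑ i, (x + r • y) i • A i := by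
    rw [sum_add_smul_smul, add_smul, smul_neg]
    abel
  rw [e1] at k1 k2
  rw [e2] at l1 l2
  refine ⟨k1, l1, ?_⟩
  simp only [Matrix.mul_neg, Matrix.neg_mul, neg_neg, trace_neg, Fintype.card_fin] at k2 l2
  have q1 := mul_le_mul_of_nonneg_left hquad (sq_nonneg r)
  have q2 := mul_le_mul_of_nonneg_left hr3 (sq_nonneg r)
  have q3 := mul_le_mul_of_nonneg_left hs (show 0 ≤ r ^ 2 * (β / 2) by positivity)
  rw [hlin] at k2
  have q4 : r ^ 3 = r ^ 2 * r := by ring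
  rw [q4] at k2 l2
  linarith

theorem BarrierBound.exists_submodule {A : Fin m → Matrix (Fin n) (Fin n) ℝ} (hn : 0 < n)
    (hm : 100 ≤ m) (hA : ∀ i, (A i).IsHermitian) (hsum : ∑ i, symmAbs (hA i) ≤ 1)
    {Φ b ε ρ β r : ℝ} {x : EuclideanSpace ℝ (Fin m)} (h : BarrierBound A Φ b x) (hΦ : 0 < Φ)
    (hbε : b ≤ ε) (hρ : 0 ≤ ρ) (hβ : 32 * Φ * ρ / (m : ℝ) ^ 2 ≤ β)
    (hr0 : 0 ≤ r) (hr1 : r ≤ 1) (hr2 : Φ * (r * (√ρ * ∑ i, ‖A i‖ + β)) ≤ 1 / 2)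
    (hr3 : 2 * barrierErrorConst n Φ (√ρ * ∑ i, ‖A i‖) β * r ≤ β / 2 * (1 / (2 * ε)) ^ 2) :
    ∃ V : Submodule ℝ (EuclideanSpace ℝ (Fin m)),
      49 / 100 * (m : ℝ) ≤ Module.finrank ℝ V ∧
      ∀ y ∈ V, ‖y‖ ^ 2 ≤ ρ → BarrierBound A Φ (b + β * r ^ 2) (x + r • y) := by
  obtain ⟨hε, hs⟩ := h.le_trace_sq hn hbε
  have hβ0 : 0 ≤ β := le_trans (by positivity) hβ
  obtain ⟨V, hV, hVy⟩ := exists_submodule_barrier hm hA hsum h.1.inv.posSemidef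
    h.2.1.inv.posSemidef hΦ h.2.2 (lt_of_lt_of_le (by positivity) hs)
  refine ⟨V, hV, fun y hy hyρ => ?_⟩
  obtain ⟨hlin, hquad⟩ := hVy y hy
  have hL : ‖∑ i, y i • A i‖ ≤ √ρ * ∑ i, ‖A i‖ :=
    (norm_sum_smul_le A y).trans (mul_le_mul_of_nonneg_right (Real.le_sqrt_of_sq_le hyρ)
      (Finset.sum_nonneg fun i _ => norm_nonneg _))
  refine h.step hA hΦ hβ0 hL rfl rfl hlin (hquad.trans ?_) hs hr0 hr1 hr2 hr3
  have hS := le_trans (by positivity) hs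
  have hm0 : (0 : ℝ) < m := by exact_mod_cast (by omega : 0 < m)
  refine (mul_le_mul_of_nonneg_left hyρ (by positivity)).trans ?_
  calc _ = (32 * Φ * ρ / (m : ℝ) ^ 2) / 2 * _ := by field_simp; ring
    _ ≤ _ := mul_le_mul_of_nonneg_right (by linarith) hS

end BarrierWalk

/-! ### From the walk to the mean width. -/

section Width

open ProbabilityTheory

/-- The support function of `K`, as an extended nonnegative real. -/
noncomputable def supportFun {m : ℕ} (K : Set (EuclideanSpace ℝ (Fin m))) (w : EuclideanSpace ℝ (Fin m)) :
    ℝ≥0∞ :=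
  ⨆ x ∈ K, ENNReal.ofReal (inner ℝ w x)

variable {n m : ℕ}

theorem measurable_supportFun (K : Set (EuclideanSpace ℝ (Fin m))) :
    Measurable (supportFun K) := by
  refine LowerSemicontinuous.measurable (lowerSemicontinuous_biSup fun x _ => ?_)
  exact (ENNReal.continuous_ofReal.comp (by fun_prop)).lowerSemicontinuous

theorem supportFun_smul (K : Set (EuclideanSpace ℝ (Fin m))) (r : ℝ)
    (w : EuclideanSpace ℝ (Fin m)) (hr : 0 < r) :
    supportFun K (r • w) = ENNReal.ofReal r * supportFun K w := by
  simp only [supportFun, real_inner_smul_left, ENNReal.ofReal_mul hr.le, ENNReal.mul_iSup]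

theorem lintegral_supportFun_le_meanWidth {K : Set (EuclideanSpace ℝ (Fin m))} (h0 : 0 ∈ K) :
    ∫⁻ a, supportFun K a ∂(uniformSphere m) ≤ meanWidth K := by
  refine lintegral_mono fun a => iSup₂_mono fun x _ => ?_
  refine le_trans ?_ (le_iSup₂ (f := fun y _ => ENNReal.ofReal
    |inner ℝ (a : EuclideanSpace ℝ (Fin m)) (x - y)|) 0 h0)
  rw [sub_zero]
  exact ENNReal.ofReal_le_ofReal (le_abs_self _)

/-- Induction on the number `j` of remaining steps, with `x` the current position and `w` the noise
so far. Since `V` is chosen for one fixed `x` at a time, no measurable selection of subspaces along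
the walk is needed. -/
theorem BarrierBound.le_lintegral_supportFun {A : Fin m → Matrix (Fin n) (Fin n) ℝ} (hn : 0 < n)
    (hm : 100 ≤ m) (hA : ∀ i, (A i).IsHermitian) (hsum : ∑ i, symmAbs (hA i) ≤ 1)
    {Φ ε β r : ℝ} (hε : 0 < ε) (hΦ : 0 < Φ) (hβ : 32 * Φ * 230 / m ≤ β)
    (hr0 : 0 ≤ r) (hr1 : r ≤ 1) (hr2 : Φ * (r * (√(230 * m) * ∑ i, ‖A i‖ + β)) ≤ 1 / 2)
    (hr3 : 2 * Matrix.barrierErrorConst n Φ (√(230 * m) * ∑ i, ‖A i‖) β * r ≤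
      β / 2 * (1 / (2 * ε)) ^ 2) (j : ℕ) {x : EuclideanSpace ℝ (Fin m)}
    (h : BarrierBound A Φ (ε - β * r ^ 2 * j) x) (w : EuclideanSpace ℝ (Fin m)) :
    ENNReal.ofReal (inner ℝ w x + 39 / 100 * m * (j * r ^ 2)) ≤
      ∫⁻ g, supportFun (opNormBody A ε) (w + √(j * r ^ 2) • g)
        ∂(stdGaussian (EuclideanSpace ℝ (Fin m))) := by
  have hm0 : (0 : ℝ) < m := by exact_mod_cast (by omega : 0 < m)
  have hβ0 : 0 ≤ β := le_trans (by positivity) hβ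
  induction j generalizing x w with
  | zero =>
    simp only [Nat.cast_zero, mul_zero, sub_zero, zero_mul, Real.sqrt_zero, zero_smul,
      add_zero] at h ⊢
    rw [lintegral_const, measure_univ, mul_one]
    exact le_iSup₂ (f := fun x _ => ENNReal.ofReal (inner ℝ w x)) x (h.mem_opNormBody hA hε)
  | succ j ih =>
    have hb : ε - β * r ^ 2 * ((j + 1 : ℕ) : ℝ) ≤ ε := by
      have : 0 ≤ β * r ^ 2 * ((j + 1 : ℕ) : ℝ) := by positivity
      linarith
    have hβ' : 32 * Φ * (230 * m) / (m : ℝ) ^ 2 ≤ β := by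
      refine le_of_eq_of_le ?_ hβ
      field_simp
    obtain ⟨V, hV, hstep⟩ := h.exists_submodule hn hm hA hsum hΦ hb
      (by positivity : (0 : ℝ) ≤ 230 * m) hβ' hr0 hr1 hr2 hr3
    have hb' : ε - β * r ^ 2 * ((j + 1 : ℕ) : ℝ) + β * r ^ 2 = ε - β * r ^ 2 * j := by
      push_cast
      ring
    rw [hb'] at hstep
    have hsemi := lintegral_stdGaussian_semigroup (measurable_supportFun (opNormBody A ε)) w
      (sq_nonneg r) (by positivity : 0 ≤ (j : ℝ) * r ^ 2)
    have hcast : ((j + 1 : ℕ) : ℝ) * r ^ 2 = r ^ 2 + j * r ^ 2 := by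
      push_cast
      ring
    rw [hcast, ← hsemi, Real.sqrt_sq hr0]
    have hgain := ofReal_inner_add_le_lintegral_stdGaussian V
      (by positivity : (0 : ℝ) < 230 * m) w x r (39 / 100 * m * (j * r ^ 2))
    refine le_trans (ENNReal.ofReal_le_ofReal ?_) (hgain.trans (lintegral_mono fun g => ?_))
    · rw [finrank_euclideanSpace_fin]
      -- The cutoff 230 m makes the truncation loss m/10, so the gain rate is 49/100 - 1/10 =
      -- 39/100.
      have h1 : 23 * (m : ℝ) ^ 2 / (230 * m) = m / 10 := by
        field_simp
        norm_num
      rw [h1]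
      nlinarith [mul_le_mul_of_nonneg_left hV (sq_nonneg r)]
    · exact ih (hstep _ (truncatedProjection_mem V _ g)
        (norm_truncatedProjection_sq_le V (by positivity) g)) _

theorem barrierBound_zero {A : Fin m → Matrix (Fin n) (Fin n) ℝ} {b : ℝ} (hb : 0 < b) :
    BarrierBound A (2 * n / b) b 0 := by
  have h1 : (b • (1 : Matrix (Fin n) (Fin n) ℝ)).PosDef := Matrix.PosDef.one.smul hb
  have h2 : (b • (1 : Matrix (Fin n) (Fin n) ℝ))⁻¹ = b⁻¹ • 1 := by
    refine Matrix.inv_eq_left_inv ?_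
    rw [Matrix.smul_mul, Matrix.mul_smul, smul_smul, inv_mul_cancel₀ hb.ne', one_smul,
      Matrix.one_mul]
  refine ⟨by simpa using h1, by simpa using h1, le_of_eq ?_⟩
  simp only [PiLp.zero_apply, zero_smul, Finset.sum_const_zero, sub_zero, add_zero, h2,
    Matrix.trace_smul, Matrix.trace_one, Fintype.card_fin, smul_eq_mul]
  field_simp
  ring

theorem exists_step_size {T B C D : ℝ} (hT : 0 < T) (hD : 0 < D) :
    ∃ k : ℕ, ∃ r : ℝ, 0 ≤ r ∧ k * r ^ 2 = T ∧ r ≤ 1 ∧ B * r ≤ 1 / 2 ∧ C * r ≤ D := by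
  have hlim : Filter.Tendsto (fun k : ℕ => √(T / k)) Filter.atTop (nhds 0) := by
    have := (tendsto_const_div_atTop_nhds_zero_nat T).sqrt
    rwa [Real.sqrt_zero] at this
  have hB : Filter.Tendsto (fun k : ℕ => B * √(T / k)) Filter.atTop (nhds 0) := by
    simpa using hlim.const_mul B
  have hC : Filter.Tendsto (fun k : ℕ => C * √(T / k)) Filter.atTop (nhds 0) := by
    simpa using hlim.const_mul C
  obtain ⟨k, h1, h2, h3, h4⟩ := ((hlim.eventually_le_const one_pos).and
    ((hB.eventually_le_const (by norm_num : (0 : ℝ) < 1 / 2)).and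
      ((hC.eventually_le_const hD).and (Filter.eventually_gt_atTop 0)))).exists
  refine ⟨k, √(T / k), Real.sqrt_nonneg _, ?_, h1, h2, h3⟩
  have hk : (0 : ℝ) < k := by exact_mod_cast h4
  rw [Real.sq_sqrt (by positivity), mul_div_cancel₀ _ hk.ne']

end Width

/-! ### Choice of constants and conclusion. -/

theorem theorem2 {n m : ℕ} (A : Fin m → Matrix (Fin n) (Fin n) ℝ)
    (hA : ∀ i, (A i).IsHermitian) (hsum : ∑ i, symmAbs (hA i) ≤ 1)
    (ε : ℝ) (hε0 : 0 < ε) (hε1 : ε < 1)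
    (hm : (m : ℝ) = (n : ℝ) / ε ^ 2) (hm100 : 100 ≤ m) :
    ENNReal.ofReal (√(m : ℝ) / 10000) < meanWidth (opNormBody A ε) := by
  have hmR : (100 : ℝ) ≤ m := by exact_mod_cast hm100
  have hnm : (n : ℝ) = m * ε ^ 2 := by
    rw [hm]
    field_simp
  have hnR : (0 : ℝ) < n := by
    rw [hnm]
    positivity
  have hn : 0 < n := by exact_mod_cast hnR
  -- The potential at the origin with the barrier at ε/2; it equals 4mε.
  set Φ : ℝ := 2 * n / (ε / 2) with hΦ
  have hΦ0 : 0 < Φ := by positivity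
  -- 29440 = 32 · 4 · 230.
  set β : ℝ := 29440 * ε with hβ
  have hβΦ : 32 * Φ * 230 / m ≤ β := by
    rw [hΦ, hβ, hnm]
    refine le_of_eq ?_
    field_simp
    norm_num
  -- T = 1/58880 gives βT = ε/2: the barrier climbs from ε/2 exactly to ε.
  obtain ⟨k, r, hr0, hkr, hr1, hr2, hr3⟩ := exists_step_size (T := 1 / 58880)
    (B := Φ * (√(230 * m) * ∑ i, ‖A i‖ + β))
    (C := 2 * Matrix.barrierErrorConst n Φ (√(230 * m) * ∑ i, ‖A i‖) β)
    (D := β / 2 * (1 / (2 * ε)) ^ 2) (by norm_num) (by positivity)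
  have hstart : BarrierBound A Φ (ε - β * r ^ 2 * k) 0 := by
    have : ε - β * r ^ 2 * k = ε / 2 := by
      rw [mul_assoc, mul_comm (r ^ 2), hkr, hβ]
      ring
    rw [this]
    exact barrierBound_zero (by positivity)
  have hmain := hstart.le_lintegral_supportFun hn hm100 hA hsum hε0 hΦ0 hβΦ hr0 hr1
    (by linarith) hr3 k 0
  rw [hkr, inner_zero_left, zero_add] at hmain
  have hs : 0 < √(1 / 58880 : ℝ) := Real.sqrt_pos.2 (by norm_num)
  simp only [zero_add, supportFun_smul _ _ _ hs] at hmain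
  rw [lintegral_const_mul _ (measurable_supportFun _)] at hmain
  have hpolar := lintegral_stdGaussian_le_sqrt_mul_uniformSphere (by omega : 0 < m)
    (measurable_supportFun (opNormBody A ε)) (supportFun_smul _)
  have hwidth := lintegral_supportFun_le_meanWidth (K := opNormBody A ε)
    (by simp [opNormBody, hε0.le])
  by_contra hcon
  rw [not_lt] at hcon
  have hfin : ENNReal.ofReal (39 / 100 * m * (1 / 58880)) ≤
      ENNReal.ofReal (√(1 / 58880) * (√m * (√m / 10000))) := by
    refine hmain.trans ?_
    rw [ENNReal.ofReal_mul hs.le, ENNReal.ofReal_mul (Real.sqrt_nonneg _)]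
    gcongr
    exact hpolar.trans (by gcongr; exact hwidth.trans hcon)
  rw [ENNReal.ofReal_le_ofReal_iff (by positivity)] at hfin
  have hsq : √(m : ℝ) * √m = m := Real.mul_self_sqrt (by positivity)
  have hsm : √(1 / 58880 : ℝ) < 1 / 200 := by
    rw [Real.sqrt_lt' (by norm_num)]
    norm_num
  have e1 : √(1 / 58880 : ℝ) * (√m * (√m / 10000)) = √(1 / 58880 : ℝ) * (m / 10000) := by
    rw [← mul_div_assoc, hsq]
  rw [e1] at hfin
  -- The left side of `hfin` exceeds 6·10⁻⁶ m, the right side is below 5·10⁻⁷ m.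
  nlinarith
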